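/- **Conventions.** All C*-algebras are unital and homomorphisms between them are unital $*$-homomorphisms. Hilbert modules are right Hilbert C*-modules, with inner products linear in the second variable; $\mathcal L_B(Z)$ is the algebra of adjointable operators on $Z$, and $\mathcal I(Z)$ the group of invertible bounded $\mathbb C$-linear maps $Z\to Z$. Let $G$ be a discrete group with identity $e$, and let $\Sigma=(A,G,\alpha,\sigma)$ and $\Theta=(B,G,\beta,\theta)$ be twisted unital discrete C*-dynamical systems. That is, $\alpha:G\to\mathrm{Aut}(A)$ and $\sigma:G\times G\to\mathcal U(A)$ satisfy $\alpha_g\alpha_h=\mathrm{Ad}(\sigma(g,h))\,\alpha_{gh}$, $\sigma(g,h)\sigma(gh,k)=\alpha_g(\sigma(h,k))\sigma(g,hk)$ and $\sigma(g,e)=\sigma(e,g)=1_A$, and similarly for $\Theta$. An *equivariant representation* of $\Sigma$ on a Hilbert $A$-module $X$ is a pair $(\rho,v)$ of a homomorphism $\rho:A\to\mathcal L_A(X)$ and a map $v:G\to\mathcal I(X)$ such that $\rho(\alpha_g(a))=v(g)\rho(a)v(g)^{-1}$, $v(g)v(h)x=\big(\rho(\sigma(g,h))\,v(gh)x\big)\cdot\sigma(g,h)^*$,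 $\alpha_g(\langle x,x'\rangle)=\langle v(g)x,v(g)x'\rangle$ and $v(g)(x\cdot a)=(v(g)x)\cdot\alpha_g(a)$. Its coefficients are the maps $T_{\rho,v,x,x'}:G\times A\to A$, $T_{\rho,v,x,x'}(g,a)=\langle x,\rho(a)v(g)x'\rangle$ for $x,x'\in X$. The Fourier–Stieltjes algebra $B(\Sigma)$ is the set of all these coefficients, for all equivariant representations of $\Sigma$; it is a linear subspace of the space of maps $G\times A\to A$ that are linear in the second variable. A *right Hilbert $A$-$B$-bimodule* is a right Hilbert $B$-module $Z$ with a left action of $A$ given by a homomorphism $A\to\mathcal L_B(Z)$. A *$(\Sigma,\Theta)$-compatible action* on $Z$ is a map $\delta:G\to\mathcal I(Z)$ with $\delta(g)(a\cdot z)=\alpha_g(a)\cdot\delta(g)z$, $\delta(g)(z\cdot b)=(\delta(g)z)\cdot\beta_g(b)$, $\delta(g)\delta(h)z=\sigma(g,h)\cdot(\delta(gh)z)\cdot\theta(g,h)^*$ and $\langle\delta(g)z,\delta(g)\zeta\rangle_B=\beta_g(\langle z,\zeta\rangle_B)$; put $S_{\delta,z,\zeta}(g,a)=\langle z,a\cdot\delta(g)\zeta\rangle_B$.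 An *$A$-$B$ imprimitivity bimodule* is a $Z$ that is both a full right Hilbert $A$-$B$-bimodule and a full left Hilbert $A$-$B$-bimodule, with inner products $\langle\cdot,\cdot\rangle_B$ and ${}_A\langle\cdot,\cdot\rangle$ such that ${}_A\langle z,z'\rangle\cdot z''=z\cdot\langle z',z''\rangle_B$. Its conjugate $\widetilde Z=\{\tilde z: z\in Z\}$ is the right Hilbert $B$-$A$-bimodule with $\lambda\tilde z=(\bar\lambda z)^\sim$, $b\cdot\tilde z=(z\cdot b^*)^\sim$, $\tilde z\cdot a=(a^*\cdot z)^\sim$ and $\langle\tilde z,\tilde\zeta\rangle_A={}_A\langle z,\zeta\rangle$; and $\tilde\delta(g)\tilde z=(\delta(g)z)^\sim$ is a $(\Theta,\Sigma)$-compatible action on $\widetilde Z$. The systems $\Sigma$ and $\Theta$ are *Morita equivalent via $(Z,\delta)$* if $Z$ is an $A$-$B$ imprimitivity bimodule and $\delta$ is a $(\Sigma,\Theta)$-compatible action of $G$ on $Z$. Products of maps are given by $(S\cdot T)(g,a)=S(g,T(g,a))$, and tensor products of modules are internal. **Proposition.** Suppose that $\Sigma$ and $\Theta$ are Morita equivalent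 via $(Z,\delta)$. 1. Let $(\rho,v)$ be an equivariant representation of $\Sigma$ on a right Hilbert $A$-module $X$. Then $Y=(\widetilde Z\otimes_A X)\otimes_A Z$ carries an equivariant representation $(\tau,w)$ of $\Theta$, determined by $\tau(b)\big((\tilde z\otimes x)\otimes z'\big)=\big((b\cdot\tilde z)\otimes x\big)\otimes z'$ and $w(g)\big((\tilde z\otimes x)\otimes z'\big)=\big(\tilde\delta(g)\tilde z\otimes v(g)x\big)\otimes\delta(g)z'$. For all $x,x'\in X$ and $z,z',\zeta,\zeta'\in Z$, $$S_{\delta,z',\zeta'}\cdot T_{\rho,v,x,x'}\cdot S_{\tilde\delta,\tilde z,\tilde\zeta}=T_{\tau,w,(\tilde z\otimes x)\otimes z',\,(\tilde\zeta\otimes x')\otimes\zeta'} .$$ In particular this map $G\times B\to B$ belongs to $B(\Theta)$. 2. For all $z,z',\zeta,\zeta'\in Z$, the formula $F_{z,z',\zeta,\zeta'}(T)=S_{\delta,z',\zeta'}\cdot T\cdot S_{\tilde\delta,\tilde z,\tilde\zeta}$ defines a linear map $F_{z,z',\zeta,\zeta'}:B(\Sigma)\to B(\Theta)$. 3. For all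 $z,z',\zeta,\zeta'\in Z$, the formula $T'\mapsto S_{\tilde\delta,\tilde z,\tilde\zeta}\cdot T'\cdot S_{\delta,z',\zeta'}$ defines a linear map $B(\Theta)\to B(\Sigma)$. -/

import Mathlib

open MulOpposite

universe u

/-! ### Hilbert modules

A right Hilbert `A`-module is a complex Banach space `X` with a right action of `A`, that is
a `Module Aᵐᵒᵖ X`, and a `CStarModule Aᵐᵒᵖ X`.  (Mathlib's `CStarModule R X` requires
`⟪x, r • y⟫ = r * ⟪x, y⟫`, so a right Hilbert `A`-module is obtained for `R = Aᵐᵒᵖ`.)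
Here `x · a` is written `op a • x`, and the `A`-valued inner product is `rinner A x y`. -/

section HilbertModule

variable (A : Type*) [CStarAlgebra A] [PartialOrder A]
  {X : Type*} [NormedAddCommGroup X] [NormedSpace ℂ X] [Module Aᵐᵒᵖ X] [CStarModule Aᵐᵒᵖ X]

/-- The `A`-valued inner product of a right Hilbert `A`-module, linear in the second variable. -/
def rinner (x y : X) : A := unop (inner Aᵐᵒᵖ x y)

theorem rinner_add_right (x y z : X) : rinner A x (y + z) = rinner A x y + rinner A x z := by
  simp [rinner]

theorem rinner_smul_right (c : ℂ) (x y : X) : rinner A x (c • y) = c • rinner A x y := by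
  simp [rinner]

theorem rinner_op_smul_right (a : A) (x y : X) :
    rinner A x (op a • y) = rinner A x y * a := by
  simp [rinner]

theorem star_rinner (x y : X) : star (rinner A x y) = rinner A y x := by
  have h := CStarModule.star_inner (A := Aᵐᵒᵖ) x y
  unfold rinner
  rw [← h]
  rfl

theorem rinner_add_left (x y z : X) : rinner A (x + y) z = rinner A x z + rinner A y z := by
  rw [← star_rinner, rinner_add_right, star_add, star_rinner, star_rinner]

theorem rinner_smul_left (c : ℂ) (x y : X) : rinner A (c • x) y = star c • rinner A x y := by
  rw [← star_rinner, rinner_smul_right, star_smul, star_rinner]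

theorem rinner_op_smul_left (a : A) (x y : X) :
    rinner A (op a • x) y = star a * rinner A x y := by
  rw [← star_rinner, rinner_op_smul_right, star_mul, star_rinner]

theorem rinner_self_nonneg (x : X) : 0 ≤ rinner A x x := by
  have h := CStarModule.inner_self_nonneg (A := Aᵐᵒᵖ) (x := x)
  exact h

theorem rinner_self_eq_zero {x : X} (h : rinner A x x = 0) : x = 0 := by
  apply (CStarModule.inner_self (A := Aᵐᵒᵖ) (x := x)).1
  exact unop_injective h

theorem norm_rinner_self (x : X) : ‖rinner A x x‖ = ‖x‖ ^ 2 :=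
  (CStarModule.norm_sq_eq Aᵐᵒᵖ (x := x)).symm

theorem ext_rinner {x y : X} (h : ∀ w, rinner A w x = rinner A w y) : x = y := by
  have h0 : ∀ w, rinner A w (x + (-1 : ℂ) • y) = 0 := by
    intro w
    rw [rinner_add_right, rinner_smul_right, h w]
    simp
  have := rinner_self_eq_zero A (h0 _)
  rw [neg_one_smul, ← sub_eq_add_neg] at this
  exact sub_eq_zero.1 this

theorem op_smul_smul_complex (a : A) (c : ℂ) (x : X) : op a • (c • x) = c • (op a • x) := by
  apply ext_rinner A
  intro w
  simp [rinner_op_smul_right, rinner_smul_right]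

theorem op_algebraMap_smul (c : ℂ) (x : X) : op (algebraMap ℂ A c) • x = c • x := by
  apply ext_rinner A
  intro w
  rw [rinner_op_smul_right, rinner_smul_right, Algebra.algebraMap_eq_smul_one]
  simp

end HilbertModule

/-- A representation of `A` on the right Hilbert `B`-module `Z`: a unital `*`-homomorphism from
`A` into the adjointable operators on `Z`.  Each `κ a` is adjointable with adjoint `κ (star a)`,
which forces it to be bounded and `B`-linear.  A right Hilbert `B`-module with such a
representation is a right Hilbert `A`-`B`-bimodule, with left action `a · z = κ a z`. -/
structure HilbertRep (A B Z : Type*) [CStarAlgebra A] [CStarAlgebra B] [PartialOrder B]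
    [NormedAddCommGroup Z] [NormedSpace ℂ Z] [Module Bᵐᵒᵖ Z] [CStarModule Bᵐᵒᵖ Z] where
  /-- the underlying unital algebra homomorphism -/
  hom : A →ₐ[ℂ] Module.End ℂ Z
  adjoint : ∀ (a : A) (z z' : Z), rinner B (hom a z) z' = rinner B z (hom (star a) z')

section HilbertRep

variable {A B Z : Type*} [CStarAlgebra A] [CStarAlgebra B] [PartialOrder B]
  [NormedAddCommGroup Z] [NormedSpace ℂ Z] [Module Bᵐᵒᵖ Z] [CStarModule Bᵐᵒᵖ Z]

instance : CoeFun (HilbertRep A B Z) (fun _ => A → Module.End ℂ Z) := ⟨fun κ => κ.hom⟩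

theorem HilbertRep.op_smul (κ : HilbertRep A B Z) (a : A) (b : B) (z : Z) :
    κ a (op b • z) = op b • κ a z := by
  apply ext_rinner B
  intro w
  have h : ∀ y, rinner B w (κ a y) = rinner B (κ (star a) w) y := by
    intro y
    rw [κ.adjoint, star_star]
  rw [h, rinner_op_smul_right, rinner_op_smul_right, h]

end HilbertRep

/-! ### Twisted systems, equivariant representations, Fourier-Stieltjes algebras -/

/-- A twisted unital discrete C*-dynamical system `(A, G, α, σ)`. -/
structure TwistedSystem (A G : Type*) [CStarAlgebra A] [Group G] where
  α : G → A ≃⋆ₐ[ℂ] A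
  σ : G → G → unitary A
  α_mul : ∀ g h a, α g (α h a) = (σ g h : A) * α (g * h) a * star (σ g h : A)
  cocycle : ∀ g h k, (σ g h : A) * (σ (g * h) k : A) = α g (σ h k : A) * (σ g (h * k) : A)
  σ_one_right : ∀ g, σ g 1 = 1
  σ_one_left : ∀ g, σ 1 g = 1

/-- An equivariant representation `(ρ, v)` of `S` on the Hilbert `A`-module `X`. -/
structure EquivariantRep {A G : Type*} [CStarAlgebra A] [PartialOrder A] [Group G]
    (S : TwistedSystem A G) (X : Type*) [NormedAddCommGroup X] [NormedSpace ℂ X]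
    [Module Aᵐᵒᵖ X] [CStarModule Aᵐᵒᵖ X] where
  ρ : HilbertRep A A X
  v : G → (X ≃L[ℂ] X)
  covariant : ∀ g a x, ρ (S.α g a) x = v g (ρ a ((v g).symm x))
  v_mul : ∀ g h x, v g (v h x) = op (star (S.σ g h : A)) • ρ (S.σ g h : A) (v (g * h) x)
  rinner_v : ∀ g x x', S.α g (rinner A x x') = rinner A (v g x) (v g x')
  v_op_smul : ∀ g (a : A) x, v g (op a • x) = op (S.α g a) • v g x

/-- The coefficient `(g, a) ↦ ⟨x, ρ(a) v(g) y⟩`.  Maps `G × A → B` which are linear in the second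
variable are represented as functions `G → A →ₗ[ℂ] B`. -/
def EquivariantRep.coeff {A G : Type*} [CStarAlgebra A] [PartialOrder A] [Group G]
    {S : TwistedSystem A G} {X : Type*} [NormedAddCommGroup X] [NormedSpace ℂ X]
    [Module Aᵐᵒᵖ X] [CStarModule Aᵐᵒᵖ X] (r : EquivariantRep S X) (x y : X) :
    G → A →ₗ[ℂ] A := fun g =>
  { toFun := fun a => rinner A x (r.ρ a (r.v g y))
    map_add' := by intro a b; simp [rinner_add_right]
    map_smul' := by intro c a; simp [rinner_smul_right] }

theorem EquivariantRep.coeff_smul {A G : Type*} [CStarAlgebra A] [PartialOrder A] [Group G]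
    {S : TwistedSystem A G} {X : Type*} [NormedAddCommGroup X] [NormedSpace ℂ X]
    [Module Aᵐᵒᵖ X] [CStarModule Aᵐᵒᵖ X] (r : EquivariantRep S X) (c : ℂ) (x x' : X) :
    r.coeff x (c • x') = c • r.coeff x x' := by
  ext g a
  simp [EquivariantRep.coeff, rinner_smul_right]

section DirectSum

variable {A G : Type*} [CStarAlgebra A] [PartialOrder A] [StarOrderedRing A] [Group G]
  {S : TwistedSystem A G}
  {X : Type*} [NormedAddCommGroup X] [NormedSpace ℂ X] [Module Aᵐᵒᵖ X] [CStarModule Aᵐᵒᵖ X]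
  {Y : Type*} [NormedAddCommGroup Y] [NormedSpace ℂ Y] [Module Aᵐᵒᵖ Y] [CStarModule Aᵐᵒᵖ Y]

theorem rinner_prod (p q : WithCStarModule Aᵐᵒᵖ (X × Y)) :
    rinner A p q = rinner A p.1 q.1 + rinner A p.2 q.2 := rfl

/-- The direct sum of two representations. -/
noncomputable def HilbertRep.prod (ρ : HilbertRep A A X) (π : HilbertRep A A Y) :
    HilbertRep A A (WithCStarModule Aᵐᵒᵖ (X × Y)) where
  hom :=
    { toFun := fun a =>
        { toFun := fun p => (WithCStarModule.equiv Aᵐᵒᵖ (X × Y)).symm (ρ a p.1, π a p.2)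
          map_add' := fun p q => Prod.ext (map_add (ρ a) p.1 q.1) (map_add (π a) p.2 q.2)
          map_smul' := fun c p => Prod.ext (map_smul (ρ a) c p.1) (map_smul (π a) c p.2) }
      map_one' := LinearMap.ext fun p => Prod.ext
        (LinearMap.congr_fun (map_one ρ.hom) p.1) (LinearMap.congr_fun (map_one π.hom) p.2)
      map_mul' := fun a b => LinearMap.ext fun p => Prod.ext
        (LinearMap.congr_fun (map_mul ρ.hom a b) p.1) (LinearMap.congr_fun (map_mul π.hom a b) p.2)
      map_zero' := LinearMap.ext fun p => Prod.ext
        (LinearMap.congr_fun (map_zero ρ.hom) p.1) (LinearMap.congr_fun (map_zero π.hom) p.2)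
      map_add' := fun a b => LinearMap.ext fun p => Prod.ext
        (LinearMap.congr_fun (map_add ρ.hom a b) p.1) (LinearMap.congr_fun (map_add π.hom a b) p.2)
      commutes' := fun c => LinearMap.ext fun p => Prod.ext
        (LinearMap.congr_fun (ρ.hom.commutes c) p.1) (LinearMap.congr_fun (π.hom.commutes c) p.2) }
  adjoint := fun a p q =>
    congrArg₂ (· + ·) (ρ.adjoint a p.1 q.1) (π.adjoint a p.2 q.2)

/-- The direct sum of two equivariant representations. -/
noncomputable def EquivariantRep.prod (r : EquivariantRep S X) (s : EquivariantRep S Y) :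
    EquivariantRep S (WithCStarModule Aᵐᵒᵖ (X × Y)) where
  ρ := r.ρ.prod s.ρ
  v := fun g => ((WithCStarModule.equivL ℂ (A := Aᵐᵒᵖ) (E := X × Y)).trans
    ((r.v g).prodCongr (s.v g))).trans (WithCStarModule.equivL ℂ (A := Aᵐᵒᵖ) (E := X × Y)).symm
  covariant := fun g a p => Prod.ext (r.covariant g a p.1) (s.covariant g a p.2)
  v_mul := fun g h p => Prod.ext (r.v_mul g h p.1) (s.v_mul g h p.2)
  rinner_v := fun g p q => (map_add (S.α g) _ _).trans
    (congrArg₂ (· + ·) (r.rinner_v g p.1 q.1) (s.rinner_v g p.2 q.2))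
  v_op_smul := fun g a p => Prod.ext (r.v_op_smul g a p.1) (s.v_op_smul g a p.2)

theorem EquivariantRep.coeff_prod (r : EquivariantRep S X) (s : EquivariantRep S Y)
    (x x' : X) (y y' : Y) :
    (r.prod s).coeff ((WithCStarModule.equiv Aᵐᵒᵖ (X × Y)).symm (x, y))
      ((WithCStarModule.equiv Aᵐᵒᵖ (X × Y)).symm (x', y')) = r.coeff x x' + s.coeff y y' := rfl

end DirectSum

/-- The zero Hilbert module. -/
instance zeroCStarModule (R : Type*) [CStarAlgebra R] [PartialOrder R] :
    CStarModule R PUnit.{u + 1} where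
  inner _ _ := 0
  inner_add_right := by simp
  inner_self_nonneg := le_refl _
  inner_self := by intro x; simp
  inner_op_smul_right := by simp
  inner_smul_right_complex := by simp
  star_inner := by simp
  norm_eq_sqrt_norm_inner_self := by intro x; simp

/-- The equivariant representation on the zero Hilbert module. -/
noncomputable def EquivariantRep.zeroRep {A G : Type*} [CStarAlgebra A] [PartialOrder A] [Group G]
    (S : TwistedSystem A G) : EquivariantRep S PUnit.{u + 1} where
  ρ :=
    { hom := AlgHom.ofLinearMap 0 (Subsingleton.elim _ _) (fun _ _ => Subsingleton.elim _ _)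
      adjoint := fun _ _ _ => rfl }
  v := fun _ => ContinuousLinearEquiv.refl ℂ _
  covariant := fun _ _ _ => rfl
  v_mul := fun _ _ _ => rfl
  rinner_v := fun g _ _ => map_zero (S.α g)
  v_op_smul := fun _ _ _ => rfl

/-- The Fourier-Stieltjes algebra `B(S)`: the set of all coefficients of equivariant
representations of `S` on right Hilbert `A`-modules, a linear subspace of the space of all maps
`G × A → A` which are linear in the second variable. -/
noncomputable def fourierStieltjes {A G : Type u} [CStarAlgebra A] [PartialOrder A]
    [StarOrderedRing A] [Group G] (S : TwistedSystem A G) : Submodule ℂ (G → A →ₗ[ℂ] A) where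
  carrier := {T | ∃ (X : Type u) (_ : NormedAddCommGroup X) (_ : NormedSpace ℂ X)
    (_ : CompleteSpace X) (_ : Module Aᵐᵒᵖ X) (_ : CStarModule Aᵐᵒᵖ X)
    (r : EquivariantRep S X) (x y : X), T = r.coeff x y}
  zero_mem' := ⟨PUnit, inferInstance, inferInstance, inferInstance, inferInstance, inferInstance,
    EquivariantRep.zeroRep S, 0, 0, rfl⟩
  add_mem' := by
    rintro _ _ ⟨X, _, _, _, _, _, r, x, x', rfl⟩ ⟨Y, _, _, _, _, _, s, y, y', rfl⟩
    exact ⟨WithCStarModule Aᵐᵒᵖ (X × Y), inferInstance, inferInstance, inferInstance,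
      inferInstance, inferInstance, r.prod s, _, _, (r.coeff_prod s x x' y y').symm⟩
  smul_mem' := by
    rintro c _ ⟨X, _, _, _, _, _, r, x, x', rfl⟩
    exact ⟨X, inferInstance, inferInstance, inferInstance, inferInstance, inferInstance, r,
      x, c • x', (r.coeff_smul c x x').symm⟩

/-! ### Compatible actions and imprimitivity bimodules -/

/-- An `(S, T)`-compatible action of `G` on the right Hilbert `A`-`B`-bimodule `Z`, whose left
action is `κ`. -/
structure CompatibleAction {A B G : Type*} [CStarAlgebra A] [CStarAlgebra B] [PartialOrder B]
    [Group G] (S : TwistedSystem A G) (T : TwistedSystem B G)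
    {Z : Type*} [NormedAddCommGroup Z] [NormedSpace ℂ Z] [Module Bᵐᵒᵖ Z] [CStarModule Bᵐᵒᵖ Z]
    (κ : HilbertRep A B Z) where
  δ : G → (Z ≃L[ℂ] Z)
  δ_left : ∀ g a z, δ g (κ a z) = κ (S.α g a) (δ g z)
  δ_right : ∀ g (b : B) z, δ g (op b • z) = op (T.α g b) • δ g z
  δ_mul : ∀ g h z, δ g (δ h z) = op (star (T.σ g h : B)) • κ (S.σ g h : A) (δ (g * h) z)
  rinner_δ : ∀ g z ζ, rinner B (δ g z) (δ g ζ) = T.α g (rinner B z ζ)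

/-- The map `S_{δ,z,ζ} : (g, a) ↦ ⟨z, a · δ(g)ζ⟩`. -/
def CompatibleAction.coeff {A B G : Type*} [CStarAlgebra A] [CStarAlgebra B] [PartialOrder B]
    [Group G] {S : TwistedSystem A G} {T : TwistedSystem B G}
    {Z : Type*} [NormedAddCommGroup Z] [NormedSpace ℂ Z] [Module Bᵐᵒᵖ Z] [CStarModule Bᵐᵒᵖ Z]
    {κ : HilbertRep A B Z} (d : CompatibleAction S T κ) (z ζ : Z) : G → A →ₗ[ℂ] B := fun g =>
  { toFun := fun a => rinner B z (κ a (d.δ g ζ))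
    map_add' := by intro a b; simp [rinner_add_right]
    map_smul' := by intro c a; simp [rinner_smul_right] }

/-- The product `(S · T)(g, a) = S(g, T(g, a))`. -/
def coeffMul {A B C G : Type*} [AddCommGroup A] [Module ℂ A] [AddCommGroup B] [Module ℂ B]
    [AddCommGroup C] [Module ℂ C] (S : G → B →ₗ[ℂ] C) (T : G → A →ₗ[ℂ] B) : G → A →ₗ[ℂ] C :=
  fun g => (S g).comp (T g)

/-- An `A`-`B` imprimitivity bimodule structure on the right Hilbert `B`-module `Z`: it is a full
right Hilbert `A`-`B`-bimodule, and a full left Hilbert `A`-`B`-bimodule with respect to an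
`A`-valued inner product `linner` (linear in the first variable), and the inner products are
related by `linner z z' · z'' = z · ⟨z', z''⟩`.  Completeness in the norm defined by `linner` is automatic,
since this norm coincides with the given one (see `norm_linner_self`). -/
structure ImprimitivityBimodule (A B Z : Type*) [CStarAlgebra A] [PartialOrder A]
    [CStarAlgebra B] [PartialOrder B]
    [NormedAddCommGroup Z] [NormedSpace ℂ Z] [Module Bᵐᵒᵖ Z] [CStarModule Bᵐᵒᵖ Z] where
  /-- the left action of `A` by adjointable operators -/
  κ : HilbertRep A B Z
  full_right : closure (Submodule.span ℂ {b : B | ∃ z z' : Z, b = rinner B z z'} : Set B) = Set.univ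
  /-- the `A`-valued inner product -/
  linner : Z → Z → A
  linner_add_left : ∀ x y z, linner (x + y) z = linner x z + linner y z
  linner_smul_left : ∀ (c : ℂ) x y, linner (c • x) y = c • linner x y
  linner_act_left : ∀ (a : A) x y, linner (κ a x) y = a * linner x y
  star_linner : ∀ x y, star (linner x y) = linner y x
  linner_self_nonneg : ∀ x, 0 ≤ linner x x
  linner_self_eq_zero : ∀ x, linner x x = 0 → x = 0
  /-- the right action of `B` is by adjointable operators for `linner` -/
  linner_adjoint : ∀ (b : B) x y, linner (op b • x) y = linner x (op (star b) • y)
  full_left : closure (Submodule.span ℂ {a : A | ∃ z z' : Z, a = linner z z'} : Set A) = Set.univ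
  linner_act : ∀ z z' z'', κ (linner z z') z'' = op (rinner B z' z'') • z

theorem CStarAlgebra.exists_star_mul_self_add {A : Type*} [CStarAlgebra A] [PartialOrder A]
    [StarOrderedRing A] (a : A) :
    ∃ c : A, star a * a + star c * c = algebraMap ℂ A ((‖a‖ ^ 2 : ℝ) : ℂ) := by
  have h : star a * a ≤ algebraMap ℝ A (‖a‖ ^ 2) := CStarAlgebra.star_mul_le_algebraMap_norm_sq
  obtain ⟨c, hc⟩ := CStarAlgebra.nonneg_iff_eq_star_mul_self.1 (sub_nonneg.2 h)
  refine ⟨c, ?_⟩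
  rw [← hc, add_sub_cancel, Algebra.algebraMap_eq_smul_one, Algebra.algebraMap_eq_smul_one,
    Complex.coe_smul]

theorem norm_le_of_add_eq_smul {B : Type*} [CStarAlgebra B] [PartialOrder B] [StarOrderedRing B]
    {p q r : B} {t : ℝ} (ht : 0 ≤ t) (hp : 0 ≤ p) (hq : 0 ≤ q) (h : p + q = (t : ℂ) • r) :
    ‖p‖ ≤ t * ‖r‖ := by
  have h1 : ‖p‖ ≤ ‖(t : ℂ) • r‖ :=
    CStarAlgebra.norm_le_norm_of_nonneg_of_le hp (h ▸ le_add_of_nonneg_right hq)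
  rwa [norm_smul, Complex.norm_real, Real.norm_of_nonneg ht] at h1

theorem le_of_cube_le {s t : ℝ} (ht : 0 ≤ t) (h : s ^ 3 ≤ t ^ 2 * s) : s ≤ t := by
  by_contra hc
  push Not at hc
  have hs' : 0 < s := lt_of_le_of_lt ht hc
  nlinarith [mul_pos hs' (mul_pos hs' hs'), mul_pos hs' (sub_pos.2 hc)]

theorem norm_cube_of_isSelfAdjoint {B : Type*} [CStarAlgebra B] {b : B} (hb : star b = b) :
    ‖b * b * b‖ = ‖b‖ ^ 3 := by
  have h2 : ‖b * b‖ = ‖b‖ * ‖b‖ := by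
    have := CStarRing.norm_star_mul_self (x := b)
    rwa [hb] at this
  have h4 : ‖(b * b) * (b * b)‖ = ‖b * b‖ * ‖b * b‖ := by
    have := CStarRing.norm_star_mul_self (x := b * b)
    rwa [star_mul, hb] at this
  have hle : ‖b * b * b‖ ≤ ‖b‖ ^ 3 := by
    calc _ ≤ ‖b * b‖ * ‖b‖ := norm_mul_le _ _
      _ = _ := by rw [h2]; ring
  refine le_antisymm hle ?_
  by_cases h0 : ‖b‖ = 0
  · rw [h0]; simp
  have h0' : 0 < ‖b‖ := lt_of_le_of_ne (norm_nonneg _) (Ne.symm h0)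
  have h5 : ‖b‖ ^ 4 ≤ ‖b * b * b‖ * ‖b‖ := by
    calc ‖b‖ ^ 4 = ‖(b * b) * (b * b)‖ := by rw [h4, h2]; ring
      _ = ‖(b * b * b) * b‖ := by simp only [mul_assoc]
      _ ≤ _ := norm_mul_le _ _
  nlinarith

namespace ImprimitivityBimodule

section Lemmas

variable {A B Z : Type*} [CStarAlgebra A] [PartialOrder A] [CStarAlgebra B] [PartialOrder B]
  [NormedAddCommGroup Z] [NormedSpace ℂ Z] [Module Bᵐᵒᵖ Z] [CStarModule Bᵐᵒᵖ Z]
  (I : ImprimitivityBimodule A B Z)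

theorem linner_add_right (x y z : Z) : I.linner x (y + z) = I.linner x y + I.linner x z := by
  rw [← I.star_linner, I.linner_add_left, star_add, I.star_linner, I.star_linner]

theorem linner_smul_right (c : ℂ) (x y : Z) : I.linner x (c • y) = star c • I.linner x y := by
  rw [← I.star_linner, I.linner_smul_left, star_smul, I.star_linner]

theorem linner_act_right (a : A) (x y : Z) :
    I.linner x (I.κ a y) = I.linner x y * star a := by
  rw [← I.star_linner, I.linner_act_left, star_mul, I.star_linner]

theorem linner_op_smul_right (b : B) (x y : Z) :
    I.linner x (op b • y) = I.linner (op (star b) • x) y := by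
  rw [I.linner_adjoint, star_star]

/-- The two norms of an imprimitivity bimodule coincide. -/
theorem norm_linner_self [StarOrderedRing A] [StarOrderedRing B] (z : Z) :
    ‖I.linner z z‖ = ‖rinner B z z‖ := by
  set a := I.linner z z with ha
  set b := rinner B z z with hb
  have hab : I.κ a z = op b • z := I.linner_act z z z
  have hsb : star b = b := star_rinner B z z
  have hsa : star a = a := I.star_linner z z
  apply le_antisymm
  · apply le_of_cube_le (norm_nonneg _)
    rw [← norm_cube_of_isSelfAdjoint hsa]
    obtain ⟨c, hc⟩ := CStarAlgebra.exists_star_mul_self_add (star b)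
    rw [star_star, norm_star] at hc
    have e1 : a * a * a = I.linner (op b • z) (op b • z) := by
      rw [← hab, I.linner_act_left, I.linner_act_right, hsa, mul_assoc]
    rw [e1]
    refine norm_le_of_add_eq_smul (q := I.linner (op (star c) • z) (op (star c) • z)) (by positivity)
      (I.linner_self_nonneg _) (I.linner_self_nonneg _) ?_
    rw [I.linner_adjoint, I.linner_adjoint, smul_smul, smul_smul, ← linner_add_right, ← add_smul,
      ← op_mul, ← op_mul, ← op_add, star_star, hc, op_algebraMap_smul, linner_smul_right]
    simp [ha]
  · apply le_of_cube_le (norm_nonneg _)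
    rw [← norm_cube_of_isSelfAdjoint hsb]
    obtain ⟨c, hc⟩ := CStarAlgebra.exists_star_mul_self_add a
    have e1 : b * b * b = rinner B (I.κ a z) (I.κ a z) := by
      rw [hab, rinner_op_smul_left, rinner_op_smul_right, hsb, mul_assoc]
    rw [e1]
    refine norm_le_of_add_eq_smul (q := rinner B (I.κ c z) (I.κ c z)) (by positivity)
      (rinner_self_nonneg _ _) (rinner_self_nonneg _ _) ?_
    rw [I.κ.adjoint, I.κ.adjoint, ← rinner_add_right, ← Module.End.mul_apply,
      ← Module.End.mul_apply, ← map_mul, ← map_mul, ← LinearMap.add_apply, ← map_add, hc,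
      I.κ.hom.commutes, Module.algebraMap_end_apply, rinner_smul_right]

end Lemmas

section Conj

variable {A B Z : Type*} [CStarAlgebra A] [PartialOrder A] [CStarAlgebra B] [PartialOrder B]
  [NormedAddCommGroup Z] [NormedSpace ℂ Z] [Module Bᵐᵒᵖ Z] [CStarModule Bᵐᵒᵖ Z]

/-- The conjugate `Z̃` of an imprimitivity bimodule `Z`.  It is the additive group `Z`, with
`c · z̃ = (c̄ z)~`, `z̃ · a = (a* · z)~`, `b · z̃ = (z · b*)~` and `⟨z̃, ζ̃⟩ = linner z ζ`. -/
@[nolint unusedArguments]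
def Conj (_I : ImprimitivityBimodule A B Z) : Type _ := Z

variable (I : ImprimitivityBimodule A B Z)

/-- The map `z ↦ z̃`. -/
def tilde (z : Z) : I.Conj := z

/-- The inverse of `z ↦ z̃`. -/
def untilde (z : I.Conj) : Z := z

noncomputable instance : NormedAddCommGroup I.Conj := inferInstanceAs (NormedAddCommGroup Z)

instance [CompleteSpace Z] : CompleteSpace I.Conj := inferInstanceAs (CompleteSpace Z)

noncomputable instance : Module ℂ I.Conj where
  smul c z := I.tilde (star c • I.untilde z)
  one_smul z := show star (1 : ℂ) • I.untilde z = z by rw [star_one, one_smul]; rfl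
  mul_smul c d z := show star (c * d) • I.untilde z = star c • star d • I.untilde z by
    rw [smul_smul, star_mul']
  smul_zero c := smul_zero (A := Z) (star c)
  smul_add c x y := smul_add (A := Z) (star c) x y
  add_smul c d z := show star (c + d) • I.untilde z = _ by rw [star_add, add_smul]; rfl
  zero_smul z := show star (0 : ℂ) • I.untilde z = _ by rw [star_zero, zero_smul]; rfl

noncomputable instance : NormedSpace ℂ I.Conj where
  norm_smul_le c z := show ‖star c • I.untilde z‖ ≤ _ by
    rw [norm_smul, norm_star]; exact le_refl _

noncomputable instance : Module Aᵐᵒᵖ I.Conj where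
  smul a z := I.tilde (I.κ (star (unop a)) (I.untilde z))
  one_smul z := show I.κ (star (1 : A)) (I.untilde z) = z by rw [star_one, map_one]; rfl
  mul_smul a b z := show I.κ (star (unop b * unop a)) (I.untilde z) =
      I.κ (star (unop a)) (I.κ (star (unop b)) (I.untilde z)) by
    rw [star_mul, map_mul]; rfl
  smul_zero a := map_zero (I.κ (star (unop a)))
  smul_add a x y := map_add (I.κ (star (unop a))) (I.untilde x) (I.untilde y)
  add_smul a b z := show I.κ (star (unop a + unop b)) (I.untilde z) = _ by
    rw [star_add, map_add]; rfl
  zero_smul z := show I.κ (star (0 : A)) (I.untilde z) = _ by rw [star_zero, map_zero]; rfl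

theorem tilde_smul (c : ℂ) (z : Z) : c • I.tilde z = I.tilde (star c • z) := rfl

theorem tilde_op_smul (a : A) (z : Z) : op a • I.tilde z = I.tilde (I.κ (star a) z) := rfl

variable [StarOrderedRing A] [StarOrderedRing B]

noncomputable instance : CStarModule Aᵐᵒᵖ I.Conj where
  inner x y := op (I.linner (I.untilde x) (I.untilde y))
  inner_add_right {x y z} := congrArg op (I.linner_add_right x y z)
  inner_self_nonneg {x} := I.linner_self_nonneg x
  inner_self {x} := by
    constructor
    · intro h
      exact I.linner_self_eq_zero x (op_injective h)
    · rintro rfl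
      have h := I.linner_smul_left 0 (0 : Z) (0 : Z)
      rw [zero_smul, zero_smul] at h
      exact congrArg op h
  inner_op_smul_right {a x y} := by
    change op (I.linner (I.untilde x) (I.κ (star (unop a)) (I.untilde y))) =
      op (I.linner (I.untilde x) (I.untilde y) * unop a)
    rw [I.linner_act_right, star_star]
  inner_smul_right_complex {c x y} := by
    change op (I.linner (I.untilde x) (star c • I.untilde y)) =
      op (c • I.linner (I.untilde x) (I.untilde y))
    rw [I.linner_smul_right, star_star]
  star_inner x y := congrArg op (I.star_linner x y)
  norm_eq_sqrt_norm_inner_self x := by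
    change ‖I.untilde x‖ = √‖I.linner (I.untilde x) (I.untilde x)‖
    rw [I.norm_linner_self, norm_rinner_self, Real.sqrt_sq (norm_nonneg _)]

theorem rinner_tilde (z ζ : Z) : rinner A (I.tilde z) (I.tilde ζ) = I.linner z ζ := rfl

/-- The left action of `B` on the conjugate bimodule, `b · z̃ = (z · b*)~`. -/
noncomputable def conjκ : HilbertRep B A I.Conj where
  hom :=
    { toFun := fun b =>
        { toFun := fun z => I.tilde (op (star b) • I.untilde z)
          map_add' := fun x y => smul_add (op (star b)) (I.untilde x) (I.untilde y)
          map_smul' := fun c x => op_smul_smul_complex B (star b) (star c) (I.untilde x) }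
      map_one' := LinearMap.ext fun z => by
        change op (star (1 : B)) • I.untilde z = I.untilde z
        rw [star_one, op_one, one_smul]
      map_mul' := fun b c => LinearMap.ext fun z => by
        change op (star (b * c)) • I.untilde z = op (star b) • op (star c) • I.untilde z
        rw [star_mul, op_mul, mul_smul]
      map_zero' := LinearMap.ext fun z => by
        change op (star (0 : B)) • I.untilde z = 0
        rw [star_zero, op_zero, zero_smul]
      map_add' := fun b c => LinearMap.ext fun z => by
        change op (star (b + c)) • I.untilde z = op (star b) • I.untilde z + op (star c) • I.untilde z
        rw [star_add, op_add, add_smul]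
      commutes' := fun c => LinearMap.ext fun z => by
        change op (star (algebraMap ℂ B c)) • I.untilde z = star c • I.untilde z
        rw [← op_algebraMap_smul B (star c), algebraMap_star_comm] }
  adjoint b z ζ := by
    change I.linner (op (star b) • I.untilde z) (I.untilde ζ) =
      I.linner (I.untilde z) (op (star (star b)) • I.untilde ζ)
    rw [I.linner_adjoint]

theorem conjκ_tilde (b : B) (z : Z) : I.conjκ b (I.tilde z) = I.tilde (op (star b) • z) := rfl

end Conj

end ImprimitivityBimodule

section ConjAction

variable {A B G Z : Type*} [CStarAlgebra A] [PartialOrder A] [StarOrderedRing A]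
  [CStarAlgebra B] [PartialOrder B] [StarOrderedRing B] [Group G]
  {S : TwistedSystem A G} {T : TwistedSystem B G}
  [NormedAddCommGroup Z] [NormedSpace ℂ Z] [Module Bᵐᵒᵖ Z] [CStarModule Bᵐᵒᵖ Z]
  {I : ImprimitivityBimodule A B Z}

/-- The left action of `A` on an imprimitivity bimodule is faithful. -/
theorem ImprimitivityBimodule.eq_of_act_eq (I : ImprimitivityBimodule A B Z) {a a' : A}
    (h : ∀ z, I.κ a z = I.κ a' z) : a = a' := by
  have h1 : ∀ c ∈ (Submodule.span ℂ {c : A | ∃ z z' : Z, c = I.linner z z'}),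
      a * c = a' * c := by
    intro c hc
    induction hc using Submodule.span_induction with
    | mem c hc =>
      obtain ⟨z, z', rfl⟩ := hc
      rw [← I.linner_act_left, h, I.linner_act_left]
    | zero => simp
    | add x y _ _ hx hy => rw [mul_add, mul_add, hx, hy]
    | smul t x _ hx => rw [mul_smul_comm, mul_smul_comm, hx]
  have h2 : (1 : A) ∈ closure (Submodule.span ℂ {c : A | ∃ z z' : Z, c = I.linner z z'} : Set A) :=
    I.full_left ▸ Set.mem_univ _
  have h3 : closure (Submodule.span ℂ {c : A | ∃ z z' : Z, c = I.linner z z'} : Set A) ⊆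
      {c | a * c = a' * c} :=
    closure_minimal h1 (isClosed_eq (by fun_prop) (by fun_prop))
  simpa using h3 h2

/-- A compatible action automatically preserves the left inner product. -/
theorem CompatibleAction.linner_δ (d : CompatibleAction S T I.κ) (g : G) (z ζ : Z) :
    I.linner (d.δ g z) (d.δ g ζ) = S.α g (I.linner z ζ) := by
  apply I.eq_of_act_eq
  intro w
  obtain ⟨w, rfl⟩ := (d.δ g).surjective w
  rw [I.linner_act, d.rinner_δ, ← d.δ_right, ← I.linner_act, d.δ_left]

/-- The `(T, S)`-compatible action `δ̃` of `G` on the conjugate `Z̃`, `δ̃(g) z̃ = (δ(g) z)~`. -/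
noncomputable def CompatibleAction.conj (d : CompatibleAction S T I.κ) :
    CompatibleAction T S I.conjκ where
  δ := fun g =>
    { toFun := fun z => I.tilde (d.δ g (I.untilde z))
      invFun := fun z => I.tilde ((d.δ g).symm (I.untilde z))
      map_add' := fun x y => map_add (d.δ g) (I.untilde x) (I.untilde y)
      map_smul' := fun c x => map_smul (d.δ g) (star c) (I.untilde x)
      left_inv := fun z => (d.δ g).symm_apply_apply (I.untilde z)
      right_inv := fun z => (d.δ g).apply_symm_apply (I.untilde z)
      continuous_toFun := (d.δ g).continuous
      continuous_invFun := (d.δ g).symm.continuous }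
  δ_left := fun g b z => by
    change d.δ g (op (star b) • I.untilde z) = op (star (T.α g b)) • d.δ g (I.untilde z)
    rw [d.δ_right, map_star]
  δ_right := fun g a z => by
    change d.δ g (I.κ (star a) (I.untilde z)) = I.κ (star (S.α g a)) (d.δ g (I.untilde z))
    rw [d.δ_left, map_star]
  δ_mul := fun g h z => by
    change d.δ g (d.δ h (I.untilde z)) = I.κ (star (star (S.σ g h : A)))
      (op (star (T.σ g h : B)) • d.δ (g * h) (I.untilde z))
    rw [d.δ_mul, star_star, I.κ.op_smul]
  rinner_δ := fun g z ζ => d.linner_δ g (I.untilde z) (I.untilde ζ)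

theorem CompatibleAction.conj_tilde (d : CompatibleAction S T I.κ) (g : G) (z : Z) :
    d.conj.δ g (I.tilde z) = I.tilde (d.δ g z) := rfl

end ConjAction

/-! ### Internal tensor products -/

/-- The Hilbert `B`-module `W`, with the bilinear map `t : (x, y) ↦ x ⊗ y`, is the internal tensor
product `X ⊗_A Y` of the right Hilbert `A`-module `X` and the right Hilbert `A`-`B`-bimodule `Y`
with left action `π`: `⟨x ⊗ y, x' ⊗ y'⟩ = ⟨y, ⟨x, x'⟩ · y'⟩`, and the simple tensors span a dense
subspace of `W`.  When `W` is complete, this determines `W` up to a unique isomorphism respecting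
simple tensors; it implies that `t` is `A`-balanced and that `(x ⊗ y) · b = x ⊗ (y · b)`. -/
structure IsInternalTensor {A B X Y W : Type*} [CStarAlgebra A] [PartialOrder A]
    [CStarAlgebra B] [PartialOrder B]
    [NormedAddCommGroup X] [NormedSpace ℂ X] [Module Aᵐᵒᵖ X] [CStarModule Aᵐᵒᵖ X]
    [NormedAddCommGroup Y] [NormedSpace ℂ Y] [Module Bᵐᵒᵖ Y] [CStarModule Bᵐᵒᵖ Y]
    [NormedAddCommGroup W] [NormedSpace ℂ W] [Module Bᵐᵒᵖ W] [CStarModule Bᵐᵒᵖ W]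
    (π : HilbertRep A B Y) (t : X →ₗ[ℂ] Y →ₗ[ℂ] W) : Prop where
  rinner_tmul : ∀ x x' y y', rinner B (t x y) (t x' y') = rinner B y (π (rinner A x x') y')
  dense_span : closure (Submodule.span ℂ {w : W | ∃ x y, w = t x y} : Set W) = Set.univ

/-! An equivariant representation of a system is the same thing as a compatible action from that
system to itself. Compatible actions compose under internal tensor products: if `X` carries an `(R,
S)`-compatible action and `Y` an `(S, T)`-compatible one, then `X ⊗_A Y` carries the diagonal `(R,
T)`-compatible action, the twist of the middle system cancelling across the tensor sign.

Coefficients turn this composition into the product of maps. Indeed `⟨x ⊗ y, c · δ(g)(x' ⊗ y')⟩ =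
⟨y, ⟨x, c · δ(g) x'⟩ · δ(g) y'⟩`, which is the coefficient of `Y` evaluated at the value of the
coefficient of `X` (`IsInternalTensor.coeffMul_coeff`). Applying this twice to `(Z̃ ⊗ X) ⊗ Z` gives
the formula of the first claim. The linear maps follow, because the product of maps is linear in its
middle factor. The opposite direction is the same argument with `Z` and `Z̃` exchanged.

The analytic work is the construction of internal tensor products and of operators on them. The form
`⟨y, ⟨x, x'⟩ · y'⟩` on the algebraic tensor product is positive because Gram matrices over a
C*-algebra have the form `C* C` (`exists_gram_eq`, `HilbertRep.sum_rinner_nonneg`); completing it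
gives the Hilbert module (`exists_isInternalTensor`). Operators are defined on algebraic tensors,
bounded there, and extended; every identity between them is then checked on simple tensors
(`IsInternalTensor.map_ext`). -/

/-! ### Hilbert modules from positive sesquilinear forms -/

section Form

variable {B V : Type*} [CStarAlgebra B] [PartialOrder B] [StarOrderedRing B]
  [AddCommGroup V] [Module ℂ V] [Module Bᵐᵒᵖ V]

/-- A `B`-valued semi-inner product on a right `B`-module, linear in the second variable. -/
structure IsSemiInner (f : V →ₗ⋆[ℂ] V →ₗ[ℂ] B) : Prop where
  star_apply : ∀ v w, star (f v w) = f w v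
  nonneg : ∀ v, 0 ≤ f v v
  op_smul_right : ∀ (b : B) v w, f v (op b • w) = f v w * b

namespace IsSemiInner

variable {f : V →ₗ⋆[ℂ] V →ₗ[ℂ] B} (hf : IsSemiInner f)

include hf

omit [StarOrderedRing B] in
theorem op_smul_left (b : B) (v w : V) : f (op b • v) w = star b * f v w := by
  rw [← hf.star_apply, hf.op_smul_right, star_mul, hf.star_apply]

omit [StarOrderedRing B] in
theorem norm_apply_comm (v w : V) : ‖f v w‖ = ‖f w v‖ := by
  rw [← hf.star_apply, norm_star]

/-- Expand `f u u ≥ 0` for `u = t (v · c) - w` with `c = f v w`, and use `c* f(v,v) c ≤ ‖f(v,v)‖ c*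
c`. The parameter `t` stays free because `f v v` may vanish, so it cannot be normalized away in
advance. -/
theorem cauchySchwarz_aux (v w : V) (t : ℝ) :
    (2 * t - t ^ 2 * ‖f v v‖) • (star (f v w) * f v w) ≤ f w w := by
  set c := f v w with hc
  have hc' : f w v = star c := (hf.star_apply v w).symm
  have h := hf.nonneg ((t : ℂ) • op c • v - w)
  have h2 : star c * f v v * c ≤ ‖f v v‖ • (star c * c) := by
    have := CStarAlgebra.star_left_conjugate_le_norm_smul (a := c) (b := f v v)
      (hb := hf.star_apply v v)
    exact this
  have e : f ((t : ℂ) • op c • v - w) ((t : ℂ) • op c • v - w) =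
      (t ^ 2) • (star c * f v v * c) - (2 * t) • (star c * c) + f w w := by
    simp only [map_sub, LinearMap.sub_apply, LinearMap.map_smulₛₗ₂, map_smul,
      hf.op_smul_left, hf.op_smul_right, hc', ← hc, Complex.conj_ofReal, smul_mul_assoc]
    simp only [Complex.coe_smul]
    module
  rw [e] at h
  calc (2 * t - t ^ 2 * ‖f v v‖) • (star c * c)
      = (2 * t) • (star c * c) - t ^ 2 • (‖f v v‖ • (star c * c)) := by module
    _ ≤ (2 * t) • (star c * c) - t ^ 2 • (star c * f v v * c) := by gcongr
    _ ≤ f w w := by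
      rw [← sub_nonneg]
      convert h using 1
      abel

/-- The Cauchy-Schwarz inequality. -/
theorem norm_apply_sq_le (v w : V) : ‖f v w‖ ^ 2 ≤ ‖f v v‖ * ‖f w w‖ := by
  have key : ∀ t : ℝ, 0 ≤ 2 * t - t ^ 2 * ‖f v v‖ →
      (2 * t - t ^ 2 * ‖f v v‖) * ‖f v w‖ ^ 2 ≤ ‖f w w‖ := by
    intro t ht
    have h := CStarAlgebra.norm_le_norm_of_nonneg_of_le
      (smul_nonneg ht (star_mul_self_nonneg (f v w))) (hf.cauchySchwarz_aux v w t)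
    rwa [norm_smul, CStarRing.norm_star_mul_self, Real.norm_of_nonneg ht, ← pow_two] at h
  rcases (norm_nonneg (f v v)).eq_or_lt with h0 | h0
  · rw [← h0] at key ⊢
    by_contra hc
    rw [zero_mul, not_le] at hc
    simp only [mul_zero, sub_zero] at key
    -- When `f v v = 0` the bound reads `2t ‖f v w‖² ≤ ‖f w w‖` for all `t ≥ 0`; this `t` makes the
    -- left side `2(‖f w w‖ + 1)`, a contradiction.
    have h1 := key ((‖f w w‖ + 1) / ‖f v w‖ ^ 2) (by positivity)
    rw [mul_assoc, div_mul_cancel₀ _ hc.ne'] at h1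
    linarith [norm_nonneg (f w w)]
  -- The value `t = ‖f v v‖⁻¹` maximizes `2t - t² ‖f v v‖`.
  · have e : 2 * ‖f v v‖⁻¹ - ‖f v v‖⁻¹ ^ 2 * ‖f v v‖ = ‖f v v‖⁻¹ := by
      field_simp
      ring
    have h1 := key ‖f v v‖⁻¹ (by rw [e]; positivity)
    rw [e, inv_mul_le_iff₀ h0] at h1
    exact h1

theorem norm_apply_le (v w : V) : ‖f v w‖ ≤ √‖f v v‖ * √‖f w w‖ := by
  rw [← Real.sqrt_mul (norm_nonneg _)]
  exact Real.le_sqrt_of_sq_le (hf.norm_apply_sq_le v w)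

theorem seminormedSpaceCore :
    letI : Norm V := ⟨fun v => √‖f v v‖⟩
    SeminormedSpace.Core ℂ V :=
  letI : Norm V := ⟨fun v => √‖f v v‖⟩
  { norm_nonneg := fun v => Real.sqrt_nonneg _
    norm_smul := fun c v => by
      change √‖f (c • v) (c • v)‖ = ‖c‖ * √‖f v v‖
      rw [LinearMap.map_smulₛₗ₂, map_smul, norm_smul, norm_smul,
        RCLike.norm_conj, ← mul_assoc, Real.sqrt_mul (by positivity),
        Real.sqrt_mul_self (norm_nonneg _)]
    norm_triangle := fun v w => by
      change √‖f (v + w) (v + w)‖ ≤ √‖f v v‖ + √‖f w w‖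
      apply Real.sqrt_le_iff.2 ⟨by positivity, ?_⟩
      have e : f (v + w) (v + w) = f v v + f v w + (f w v + f w w) := by
        simp only [map_add, LinearMap.add_apply]
        abel
      rw [e]
      calc _ ≤ ‖f v v + f v w‖ + ‖f w v + f w w‖ := norm_add_le _ _
        _ ≤ ‖f v v‖ + ‖f v w‖ + (‖f w v‖ + ‖f w w‖) :=
          add_le_add (norm_add_le _ _) (norm_add_le _ _)
        _ ≤ √‖f v v‖ ^ 2 + √‖f v v‖ * √‖f w w‖ + (√‖f v v‖ * √‖f w w‖ + √‖f w w‖ ^ 2) := by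
          rw [hf.norm_apply_comm w v, Real.sq_sqrt (norm_nonneg _), Real.sq_sqrt (norm_nonneg _)]
          gcongr <;> exact hf.norm_apply_le v w
        _ = _ := by ring }

omit [StarOrderedRing B] in
theorem sqrt_norm_op_smul_le (b : B) (v : V) :
    √‖f (op b • v) (op b • v)‖ ≤ ‖b‖ * √‖f v v‖ := by
  rw [hf.op_smul_left, hf.op_smul_right]
  apply Real.sqrt_le_iff.2 ⟨by positivity, ?_⟩
  rw [mul_pow, Real.sq_sqrt (norm_nonneg _)]
  calc _ ≤ ‖star b‖ * (‖f v v‖ * ‖b‖) :=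
      (norm_mul_le _ _).trans (mul_le_mul_of_nonneg_left (norm_mul_le _ _) (norm_nonneg _))
    _ = _ := by rw [norm_star]; ring

end IsSemiInner

end Form

/-! ### Completion of a semi-inner product module to a Hilbert module. -/

section Completion

open UniformSpace

theorem IsSemiInner.exists_completion_of_norm_eq {B : Type*} {V : Type u} [CStarAlgebra B]
    [PartialOrder B] [StarOrderedRing B] [SeminormedAddCommGroup V] [NormedSpace ℂ V]
    [Module Bᵐᵒᵖ V] {f : V →ₗ⋆[ℂ] V →ₗ[ℂ] B} (hf : IsSemiInner f)
    (norm_def : ∀ v, ‖v‖ = √‖f v v‖) :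
    ∃ (W : Type u) (_ : NormedAddCommGroup W) (_ : NormedSpace ℂ W) (_ : CompleteSpace W)
      (_ : Module Bᵐᵒᵖ W) (_ : CStarModule Bᵐᵒᵖ W) (q : V →ₗ[ℂ] W),
      (∀ v w, rinner B (q v) (q w) = f v w) ∧ DenseRange q := by
  -- Right multiplication by `b` is Lipschitz with constant `‖b‖`, so the module structure passes to
  -- the completion.
  have : UniformContinuousConstSMul Bᵐᵒᵖ V := ⟨fun b => by
    refine (LipschitzWith.of_dist_le_mul (K := ‖b.unop‖₊) fun v w => ?_).uniformContinuous
    rw [dist_eq_norm, dist_eq_norm, ← smul_sub]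
    simp only [norm_def]
    exact hf.sqrt_norm_op_smul_le b.unop (v - w)⟩
  let fL : V →L⋆[ℂ] V →L[ℂ] B := LinearMap.mkContinuous₂ f 1 fun v w => by
    rw [one_mul, norm_def, norm_def]
    exact hf.norm_apply_le v w
  have hfL : Continuous fun p : V × V => f p.1 p.2 := by
    change Continuous fun p : V × V => fL p.1 p.2
    fun_prop
  -- The extension theorem for bilinear maps is about biadditive maps, hence the repackaging of `f`.
  let φ : V →+ V →+ B :=
    { toFun := fun v => (f v).toAddMonoidHom
      map_zero' := by ext; simp
      map_add' := fun _ _ => by ext; simp }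
  obtain ⟨F, hFc, hF⟩ : ∃ F : Completion V × Completion V → B, Continuous F ∧
      ∀ v w : V, F (v, w) = f v w :=
    ⟨(Completion.isDenseInducing_coe.prodMap Completion.isDenseInducing_coe).extend
        fun p : V × V => φ p.1 p.2,
      (Completion.isDenseInducing_toCompl V).extend_Z_bilin
        (Completion.isDenseInducing_toCompl V) (φ := φ) hfL,
      fun v w => (Completion.isDenseInducing_coe.prodMap Completion.isDenseInducing_coe).extend_eq
        hfL (v, w)⟩
  -- Each Hilbert module axiom is a closed condition that holds on the dense image of `V`.
  -- Definiteness follows from this norm formula, since the completion is separated.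
  have hnorm : ∀ w : Completion V, ‖w‖ = √‖F (w, w)‖ := fun w =>
    Completion.induction_on w (isClosed_eq (by fun_prop) (by fun_prop))
      fun v => by rw [hF, Completion.norm_coe, norm_def]
  have hadd : ∀ x y z : Completion V, F (x, y + z) = F (x, y) + F (x, z) := by
    intro x y z
    refine Completion.induction_on₃ x y z ?_ fun a b c => ?_
    · have h1 : Continuous fun p : Completion V × Completion V × Completion V =>
          F (p.1, p.2.1 + p.2.2) := by fun_prop
      have h2 : Continuous fun p : Completion V × Completion V × Completion V =>
          F (p.1, p.2.1) + F (p.1, p.2.2) := by fun_prop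
      exact isClosed_eq h1 h2
    · rw [← Completion.coe_add, hF, hF, hF, map_add]
  have hsmul : ∀ (c : ℂ) (x y : Completion V), F (x, c • y) = c • F (x, y) := fun c x y =>
    Completion.induction_on₂ x y
      (isClosed_eq (hFc.comp (continuous_fst.prodMk (continuous_snd.const_smul c)))
        (hFc.const_smul c))
      fun a b => by rw [← Completion.coe_smul, hF, hF, map_smul]
  have hop : ∀ (c : B) (x y : Completion V), F (x, op c • y) = F (x, y) * c := fun c x y =>
    Completion.induction_on₂ x y
      (isClosed_eq (hFc.comp (continuous_fst.prodMk (continuous_snd.const_smul (op c))))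
        (by fun_prop))
      fun a b => by rw [← Completion.coe_smul, hF, hF, hf.op_smul_right]
  have hstar : ∀ x y : Completion V, star (F (x, y)) = F (y, x) := fun x y =>
    Completion.induction_on₂ x y
      (isClosed_eq (by fun_prop) (by fun_prop))
      fun a b => by rw [hF, hF, hf.star_apply]
  have hpos : ∀ x : Completion V, 0 ≤ F (x, x) := fun x =>
    Completion.induction_on x
      (isClosed_le (by fun_prop) (by fun_prop))
      fun a => by rw [hF]; exact hf.nonneg a
  let : CStarModule Bᵐᵒᵖ (Completion V) :=
    { inner := fun x y => op (F (x, y))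
      inner_add_right := congrArg op (hadd _ _ _)
      inner_self_nonneg := hpos _
      inner_self := fun {x} => by
        rw [op_eq_zero_iff, ← norm_eq_zero (a := x), hnorm,
          Real.sqrt_eq_zero (norm_nonneg _), norm_eq_zero]
      inner_op_smul_right := fun {a x y} => congrArg op (hop a.unop x y)
      inner_smul_right_complex := congrArg op (hsmul _ _ _)
      star_inner := fun x y => congrArg op (hstar x y)
      norm_eq_sqrt_norm_inner_self := hnorm }
  exact ⟨Completion V, inferInstance, inferInstance, inferInstance, inferInstance, inferInstance,
    Completion.toComplₗᵢ.toLinearMap, hF, Completion.denseRange_coe⟩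

theorem IsSemiInner.exists_completion {B : Type*} {V : Type u} [CStarAlgebra B] [PartialOrder B]
    [StarOrderedRing B] [AddCommGroup V] [Module ℂ V] [Module Bᵐᵒᵖ V]
    {f : V →ₗ⋆[ℂ] V →ₗ[ℂ] B} (hf : IsSemiInner f) :
    ∃ (W : Type u) (_ : NormedAddCommGroup W) (_ : NormedSpace ℂ W) (_ : CompleteSpace W)
      (_ : Module Bᵐᵒᵖ W) (_ : CStarModule Bᵐᵒᵖ W) (q : V →ₗ[ℂ] W),
      (∀ v w, rinner B (q v) (q w) = f v w) ∧ DenseRange q :=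
  letI : Norm V := ⟨fun v => √‖f v v‖⟩
  letI : SeminormedAddCommGroup V := .ofCore hf.seminormedSpaceCore
  letI : NormedSpace ℂ V := { norm_smul_le := fun c v => (hf.seminormedSpaceCore.norm_smul c v).le }
  hf.exists_completion_of_norm_eq fun _ => rfl

end Completion

/-! ### Positivity of Gram matrices -/

section Gram

variable {A : Type*} [CStarAlgebra A] [PartialOrder A] [StarOrderedRing A]
  {ι : Type*} [Fintype ι]

/-- Here `N` is the negative part of `M`: since `M = M⁺ - M⁻` and `M⁻ M⁺ = 0`, compressing `M` by
`N` gives `-N³`. The conclusion uses only products and stars, ready for entrywise computation in a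
matrix algebra. -/
theorem IsSelfAdjoint.exists_mul_self_mul_eq_neg {M : A} (hM : IsSelfAdjoint M) :
    ∃ N E : A, star N = N ∧ N = star E * E ∧ N * M * N = -(N * N * N) ∧
      (N = 0 → ∃ C, M = star C * C) := by
  have hN : 0 ≤ M⁻ := CFC.negPart_nonneg M
  obtain ⟨E, hE⟩ := CStarAlgebra.nonneg_iff_eq_star_mul_self.1 hN
  refine ⟨M⁻, E, hN.isSelfAdjoint, hE, ?_, fun h =>
    CStarAlgebra.nonneg_iff_eq_star_mul_self.1 ((CFC.negPart_eq_zero_iff M hM).1 h)⟩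
  nth_rewrite 2 [← CFC.posPart_sub_negPart M hM]
  rw [mul_sub, CFC.negPart_mul_posPart, zero_sub, neg_mul]

omit [PartialOrder A] [StarOrderedRing A] in
theorem CStarMatrix.star_mul_self_diag (D : CStarMatrix ι ι A) (k : ι) :
    (star D * D) k k = ∑ i, star (D i k) * D i k := by
  rw [CStarMatrix.mul_apply]
  rfl

/-- A diagonal entry of `D* D` is a sum of positive terms `(D i k)* (D i k)`; if the sum is also
nonpositive, every term vanishes. -/
theorem CStarMatrix.eq_zero_of_star_mul_self_diag_nonpos {D : CStarMatrix ι ι A}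
    (h : ∀ k, (star D * D) k k ≤ 0) : D = 0 := by
  ext i k
  have h1 : ∑ i, star (D i k) * D i k = 0 :=
    le_antisymm (D.star_mul_self_diag k ▸ h k)
      (Finset.sum_nonneg fun i _ => star_mul_self_nonneg (D i k))
  have h2 := (Finset.sum_eq_zero_iff_of_nonneg
    fun i _ => star_mul_self_nonneg (D i k)).1 h1 i (Finset.mem_univ i)
  exact (CStarRing.star_mul_self_eq_zero_iff _).1 h2

/-- A self-adjoint matrix `M` with `∑ i j, (c i)* (M i j) (c j) ≥ 0` for all vectors `c` is of the
form `C* C`. -/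
theorem CStarMatrix.exists_eq_star_mul_self (M : CStarMatrix ι ι A) (hM : star M = M)
    (h : ∀ c : ι → A, 0 ≤ ∑ i, ∑ j, star (c i) * M i j * c j) :
    ∃ C : CStarMatrix ι ι A, M = star C * C := by
  classical
  obtain ⟨N, E, hNs, hE, hNMN, hNM⟩ := IsSelfAdjoint.exists_mul_self_mul_eq_neg (M := M) hM
  have hD : N * N * N = star (E * N) * (E * N) := by
    rw [star_mul, hNs, mul_assoc N, mul_assoc N, ← mul_assoc (star E), ← hE]
  have hEN : E * N = 0 := by
    apply CStarMatrix.eq_zero_of_star_mul_self_diag_nonpos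
    intro k
    -- Testing positivity on the `k`-th column of `N` gives `0 ≤ (N M N) k k`, which is minus the
    -- `k`-th diagonal entry of `(E N)* (E N)`.
    have h1 := h fun i => N i k
    have h2 : ∑ i, ∑ j, star (N i k) * M i j * N j k = (N * M * N) k k := by
      nth_rewrite 3 [← hNs]
      simp only [CStarMatrix.mul_apply, Finset.sum_mul]
      exact Finset.sum_comm
    rw [h2, hNMN, hD] at h1
    exact neg_nonneg.1 h1
  -- `N² = E* (E N) = 0`, so the negative part of `M` vanishes.
  have hNN : star N * N = 0 := by
    rw [hNs]
    nth_rewrite 1 [hE]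
    rw [mul_assoc, hEN, mul_zero]
  exact hNM ((CStarRing.star_mul_self_eq_zero_iff _).1 hNN)

variable {B X Y : Type*} [CStarAlgebra B] [PartialOrder B] [StarOrderedRing B]
  [NormedAddCommGroup X] [NormedSpace ℂ X] [Module Aᵐᵒᵖ X] [CStarModule Aᵐᵒᵖ X]
  [NormedAddCommGroup Y] [NormedSpace ℂ Y] [Module Bᵐᵒᵖ Y] [CStarModule Bᵐᵒᵖ Y]

omit [StarOrderedRing A] in
theorem rinner_sum_right {κ : Type*} (s : Finset κ) (x : X) (y : κ → X) :
    rinner A x (∑ i ∈ s, y i) = ∑ i ∈ s, rinner A x (y i) :=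
  map_sum (AddMonoidHom.mk' (rinner A x) (rinner_add_right A x)) y s

omit [StarOrderedRing A] in
theorem rinner_sum_left {κ : Type*} (s : Finset κ) (x : κ → X) (y : X) :
    rinner A (∑ i ∈ s, x i) y = ∑ i ∈ s, rinner A (x i) y :=
  map_sum (AddMonoidHom.mk' (fun x => rinner A x y) fun a b => rinner_add_left A a b y) x s

/-- The Gram matrix of a finite family in a Hilbert module is of the form `C* C`. -/
theorem exists_gram_eq (x : ι → X) :
    ∃ C : ι → ι → A, ∀ i j, rinner A (x i) (x j) = ∑ k, star (C k i) * C k j := by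
  obtain ⟨C, hC⟩ := CStarMatrix.exists_eq_star_mul_self
    (CStarMatrix.ofMatrix (Matrix.of fun i j => rinner A (x i) (x j)))
    (by ext i j; exact star_rinner A (x j) (x i))
    (fun c => by
      -- The value of the Gram matrix on the vector `c` is the inner square of `∑ x i · c i`.
      have h := rinner_self_nonneg A (∑ i, op (c i) • x i)
      simp only [rinner_sum_left, rinner_sum_right, rinner_op_smul_left, rinner_op_smul_right,
        Finset.sum_mul] at h
      rw [Finset.sum_comm] at h
      exact h)
  refine ⟨fun k i => C k i, fun i j => ?_⟩
  have := congrFun (congrFun hC i) j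
  rw [CStarMatrix.mul_apply] at this
  exact this

/-- With the Gram matrix of `x` written as `C* C`, moving the factors `(C k i)*` to the left
variable turns the double sum into `∑ k, ⟨u k, u k⟩` with `u k = ∑ i, C k i · y i`. This is the
positivity of the form on the algebraic tensor product. -/
theorem HilbertRep.sum_rinner_nonneg (π : HilbertRep A B Y) (x : ι → X) (y : ι → Y) :
    0 ≤ ∑ i, ∑ j, rinner B (y i) (π (rinner A (x i) (x j)) (y j)) := by
  obtain ⟨C, hC⟩ := exists_gram_eq (A := A) x
  have e : ∑ i, ∑ j, rinner B (y i) (π (rinner A (x i) (x j)) (y j)) =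
      ∑ k, rinner B (∑ i, π (C k i) (y i)) (∑ j, π (C k j) (y j)) := by
    simp only [hC, map_sum, LinearMap.sum_apply, map_mul, Module.End.mul_apply, rinner_sum_left,
      rinner_sum_right, π.adjoint]
    rw [Finset.sum_congr rfl fun i _ => Finset.sum_comm, Finset.sum_comm]
    exact Finset.sum_congr rfl fun k _ => Finset.sum_comm
  rw [e]
  exact Finset.sum_nonneg fun k _ => rinner_self_nonneg B _

end Gram

/-! ### Existence and functoriality of internal tensor products -/

section InternalTensor

open scoped TensorProduct

section Existence

variable {A : Type*} {B : Type*} {X Y : Type*} [CStarAlgebra A] [PartialOrder A]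
  [StarOrderedRing A] [CStarAlgebra B] [PartialOrder B] [StarOrderedRing B]
  [NormedAddCommGroup X] [NormedSpace ℂ X] [Module Aᵐᵒᵖ X] [CStarModule Aᵐᵒᵖ X]
  [NormedAddCommGroup Y] [NormedSpace ℂ Y] [Module Bᵐᵒᵖ Y] [CStarModule Bᵐᵒᵖ Y]

omit [StarOrderedRing A] [StarOrderedRing B] in
/-- The sesquilinear form `⟨y ⊗ x, y' ⊗ x'⟩ = ⟨y, ⟨x, x'⟩ · y'⟩`. -/
noncomputable def HilbertRep.tensorForm (π : HilbertRep A B Y) :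
    Y ⊗[ℂ] X →ₗ⋆[ℂ] Y ⊗[ℂ] X →ₗ[ℂ] B :=
  TensorProduct.lift (LinearMap.mk₂'ₛₗ (starRingEnd ℂ) (starRingEnd ℂ)
    (fun y x => TensorProduct.lift (LinearMap.mk₂ ℂ
      (fun y' x' => rinner B y (π (rinner A x x') y'))
      (fun y₁ y₂ x' => by rw [map_add, rinner_add_right])
      (fun c y₁ x' => by rw [map_smul, rinner_smul_right])
      (fun y₁ x₁ x₂ => by rw [rinner_add_right, map_add, LinearMap.add_apply, rinner_add_right])
      (fun c y₁ x₁ => by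
        rw [rinner_smul_right, map_smul, LinearMap.smul_apply, rinner_smul_right])))
    (fun y₁ y₂ x => by ext; simp [rinner_add_left])
    (fun c y₁ x => by ext; simp [rinner_smul_left])
    (fun y₁ x₁ x₂ => by ext; simp [rinner_add_left, rinner_add_right])
    (fun c y₁ x₁ => by ext; simp [rinner_smul_left, rinner_smul_right]))

omit [StarOrderedRing A] [StarOrderedRing B] in
theorem HilbertRep.tensorForm_tmul (π : HilbertRep A B Y) (x x' : X) (y y' : Y) :
    π.tensorForm (y ⊗ₜ[ℂ] x) (y' ⊗ₜ[ℂ] x') = rinner B y (π (rinner A x x') y') := rfl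

/-- Commuting scalars are what lets `Bᵐᵒᵖ` act on `Y ⊗[ℂ] X` through its left factor. -/
theorem smulCommClass_complex (B Y : Type*) [CStarAlgebra B] [PartialOrder B]
    [NormedAddCommGroup Y] [NormedSpace ℂ Y] [Module Bᵐᵒᵖ Y] [CStarModule Bᵐᵒᵖ Y] :
    SMulCommClass ℂ Bᵐᵒᵖ Y :=
  ⟨fun c b y => (op_smul_smul_complex B b.unop c y).symm⟩

/-- The factor `Y` stands first because the scalar action on a tensor product used here is that on
the left factor, and `B` acts on `Y`. -/
theorem HilbertRep.isSemiInner_tensorForm [SMulCommClass ℂ Bᵐᵒᵖ Y] (π : HilbertRep A B Y) :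
    IsSemiInner (π.tensorForm (X := X)) where
  star_apply u w := by
    induction u with
    | zero => simp
    | add u₁ u₂ h₁ h₂ => rw [map_add, LinearMap.add_apply, star_add, h₁, h₂, map_add]
    | tmul y x =>
      induction w with
      | zero => simp
      | add w₁ w₂ h₁ h₂ => rw [map_add, star_add, h₁, h₂, map_add, LinearMap.add_apply]
      | tmul y' x' =>
        rw [π.tensorForm_tmul, π.tensorForm_tmul, star_rinner, π.adjoint, star_rinner]
  nonneg u := by
    obtain ⟨n, y, x, rfl⟩ := TensorProduct.exists_sum_tmul_eq u
    simp only [map_sum, LinearMap.sum_apply, π.tensorForm_tmul]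
    rw [Finset.sum_comm]
    exact π.sum_rinner_nonneg x y
  op_smul_right b u w := by
    induction w with
    | zero => simp
    | add w₁ w₂ h₁ h₂ => rw [smul_add, map_add, h₁, h₂, map_add, add_mul]
    | tmul y' x' =>
      rw [TensorProduct.smul_tmul']
      induction u with
      | zero => simp
      | add u₁ u₂ h₁ h₂ =>
        rw [map_add, LinearMap.add_apply, h₁, h₂, LinearMap.add_apply, add_mul]
      | tmul y x =>
        rw [π.tensorForm_tmul, π.tensorForm_tmul, π.op_smul, rinner_op_smul_right]

end Existence

variable {A B X Y : Type*} [CStarAlgebra A] [PartialOrder A] [CStarAlgebra B] [PartialOrder B]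
  [StarOrderedRing B]
  [NormedAddCommGroup X] [NormedSpace ℂ X] [Module Aᵐᵒᵖ X] [CStarModule Aᵐᵒᵖ X]
  [NormedAddCommGroup Y] [NormedSpace ℂ Y] [Module Bᵐᵒᵖ Y] [CStarModule Bᵐᵒᵖ Y]

/-- The tensor product over `ℂ` suffices: the elements `x · a ⊗ y - x ⊗ a · y` have length zero for
the form, so the completion imposes the `A`-balancing by itself. -/
theorem exists_isInternalTensor {X Y : Type u} [StarOrderedRing A]
    [NormedAddCommGroup X] [NormedSpace ℂ X] [Module Aᵐᵒᵖ X] [CStarModule Aᵐᵒᵖ X]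
    [NormedAddCommGroup Y] [NormedSpace ℂ Y] [Module Bᵐᵒᵖ Y] [CStarModule Bᵐᵒᵖ Y]
    (π : HilbertRep A B Y) :
    ∃ (W : Type u) (_ : NormedAddCommGroup W) (_ : NormedSpace ℂ W) (_ : CompleteSpace W)
      (_ : Module Bᵐᵒᵖ W) (_ : CStarModule Bᵐᵒᵖ W) (t : X →ₗ[ℂ] Y →ₗ[ℂ] W),
      IsInternalTensor π t := by
  have := smulCommClass_complex B Y
  obtain ⟨W, _, _, _, _, _, q, hq, hd⟩ :=
    (π.isSemiInner_tensorForm (X := X)).exists_completion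
  refine ⟨W, inferInstance, inferInstance, inferInstance, inferInstance, inferInstance,
    ((TensorProduct.mk ℂ Y X).flip).compr₂ q, ⟨fun x x' y y' => hq _ _, ?_⟩⟩
  rw [← hd.closure_range]
  refine congrArg closure (Set.Subset.antisymm ?_ ?_)
  · change Submodule.span ℂ _ ≤ LinearMap.range q
    rw [Submodule.span_le]
    rintro _ ⟨x, y, rfl⟩
    exact ⟨y ⊗ₜ x, rfl⟩
  · rintro _ ⟨u, rfl⟩
    induction u with
    | zero => rw [map_zero]; exact Submodule.zero_mem _
    | add u₁ u₂ h₁ h₂ => rw [map_add]; exact Submodule.add_mem _ h₁ h₂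
    | tmul y x => exact Submodule.subset_span ⟨x, y, rfl⟩

variable {W : Type*} [NormedAddCommGroup W] [NormedSpace ℂ W] [Module Bᵐᵒᵖ W] [CStarModule Bᵐᵒᵖ W]

section Continuity

variable (B)

theorem continuous_rinner : Continuous fun p : W × W => rinner B p.1 p.2 :=
  continuous_unop.comp CStarModule.continuous_inner

omit [StarOrderedRing B] in
theorem norm_op_smul_le (b : B) (w : W) : ‖op b • w‖ ≤ ‖b‖ * ‖w‖ := by
  rw [← sq_le_sq₀ (norm_nonneg _) (by positivity), ← norm_rinner_self B, rinner_op_smul_left,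
    rinner_op_smul_right, mul_pow, ← norm_rinner_self B w]
  calc _ ≤ ‖star b‖ * (‖rinner B w w‖ * ‖b‖) :=
      (norm_mul_le _ _).trans (mul_le_mul_of_nonneg_left (norm_mul_le _ _) (norm_nonneg _))
    _ = _ := by rw [norm_star]; ring

omit [StarOrderedRing B] in
theorem continuous_op_smul (b : B) : Continuous fun w : W => op b • w :=
  AddMonoidHomClass.continuous_of_bound (DistribSMul.toAddMonoidHom W (op b)) ‖b‖
    (norm_op_smul_le B b)

end Continuity

/-- Choose `c` with `a* a + c* c = ‖a‖²`; then `⟨a y, a y⟩ + ⟨c y, c y⟩ = ‖a‖² ⟨y, y⟩` with both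
summands positive. -/
theorem HilbertRep.norm_apply_le [StarOrderedRing A] (κ : HilbertRep A B Y) (a : A) (y : Y) :
    ‖κ a y‖ ≤ ‖a‖ * ‖y‖ := by
  obtain ⟨c, hc⟩ := CStarAlgebra.exists_star_mul_self_add a
  rw [← sq_le_sq₀ (norm_nonneg _) (by positivity), ← norm_rinner_self B, mul_pow,
    ← norm_rinner_self B y]
  refine norm_le_of_add_eq_smul (q := rinner B (κ c y) (κ c y)) (by positivity)
    (rinner_self_nonneg _ _) (rinner_self_nonneg _ _) ?_
  rw [κ.adjoint, κ.adjoint, ← rinner_add_right, ← Module.End.mul_apply,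
    ← Module.End.mul_apply, ← map_mul, ← map_mul, ← LinearMap.add_apply, ← map_add, hc,
    κ.hom.commutes, Module.algebraMap_end_apply, rinner_smul_right]

theorem HilbertRep.continuous_apply [StarOrderedRing A] (κ : HilbertRep A B Y) (a : A) :
    Continuous (κ a) :=
  AddMonoidHomClass.continuous_of_bound (κ a) ‖a‖ (κ.norm_apply_le a)

namespace IsInternalTensor

variable {π : HilbertRep A B Y} {t : X →ₗ[ℂ] Y →ₗ[ℂ] W} (ht : IsInternalTensor π t)

include ht

omit [StarOrderedRing B] in
theorem denseRange_lift : DenseRange (TensorProduct.lift t) := by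
  rw [denseRange_iff_closure_range, ← Set.univ_subset_iff, ← ht.dense_span]
  refine closure_mono ?_
  change Submodule.span ℂ _ ≤ LinearMap.range (TensorProduct.lift t)
  rw [Submodule.span_le]
  rintro _ ⟨x, y, rfl⟩
  exact ⟨x ⊗ₜ y, TensorProduct.lift.tmul x y⟩

omit [StarOrderedRing B] in
-- The workhorse for identities on `W`. Only additivity is asked, so that it also covers
-- conjugate-linear maps such as `u ↦ rinner B u w`.
theorem map_ext {E : Type*} [TopologicalSpace E] [T2Space E] [AddCommMonoid E]
    {f g : W → E} (hf : Continuous f) (hg : Continuous g)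
    (hfa : ∀ u w, f (u + w) = f u + f w) (hga : ∀ u w, g (u + w) = g u + g w)
    (h0 : f 0 = g 0) (h : ∀ x y, f (t x y) = g (t x y)) (w : W) : f w = g w := by
  refine congrFun (ht.denseRange_lift.equalizer hf hg (funext fun u => ?_)) w
  change f (TensorProduct.lift t u) = g (TensorProduct.lift t u)
  induction u with
  | zero => rw [map_zero, h0]
  | add u₁ u₂ h₁ h₂ => rw [map_add, hfa, hga, h₁, h₂]
  | tmul x y => exact h x y

theorem eq_of_rinner_eq {w w' : W}
    (h : ∀ x y, rinner B (t x y) w = rinner B (t x y) w') : w = w' := by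
  refine ext_rinner B fun u => ?_
  refine ht.map_ext (f := fun u => rinner B u w) (g := fun u => rinner B u w')
    ((continuous_rinner B).comp (.prodMk_left w)) ((continuous_rinner B).comp (.prodMk_left w'))
    (fun _ _ => rinner_add_left B _ _ _) (fun _ _ => rinner_add_left B _ _ _) ?_ h u
  simp [rinner]

theorem op_smul_tmul (b : B) (x : X) (y : Y) : op b • t x y = t x (op b • y) := by
  refine ht.eq_of_rinner_eq fun x' y' => ?_
  rw [rinner_op_smul_right, ht.rinner_tmul, ht.rinner_tmul, π.op_smul, rinner_op_smul_right]

/-- Balancing is forced by the inner product formula: both sides pair equally with all simple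
tensors, and these separate points. -/
theorem op_smul_tmul_eq (a : A) (x : X) (y : Y) : t (op a • x) y = t x (π a y) := by
  refine ht.eq_of_rinner_eq fun x' y' => ?_
  rw [ht.rinner_tmul, ht.rinner_tmul, rinner_op_smul_right, map_mul, Module.End.mul_apply]

omit [StarOrderedRing B] in
/-- A densely defined bounded operator extends to the internal tensor product. -/
theorem exists_extension [CompleteSpace W] (f : X →ₗ[ℂ] X) (g : Y →ₗ[ℂ] Y) (C : ℝ)
    (h : ∀ u, ‖TensorProduct.lift t (TensorProduct.map f g u)‖ ≤ C * ‖TensorProduct.lift t u‖) :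
    ∃ F : W →L[ℂ] W, ∀ x y, F (t x y) = t (f x) (g y) :=
  -- The bound also gives well-definedness, as it sends tensors with zero image in `W` to zero.
  ⟨(TensorProduct.lift t ∘ₗ TensorProduct.map f g).extendOfNorm (TensorProduct.lift t),
    fun x y => LinearMap.extendOfNorm_eq ht.denseRange_lift ⟨C, h⟩ (x ⊗ₜ y)⟩

end IsInternalTensor

end InternalTensor

/-! ### Left actions and diagonal group actions on internal tensor products. -/

section InternalTensorMaps

open scoped TensorProduct

variable {A B X Y W : Type*} [CStarAlgebra A] [PartialOrder A] [CStarAlgebra B] [PartialOrder B]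
  [StarOrderedRing B]
  [NormedAddCommGroup X] [NormedSpace ℂ X] [Module Aᵐᵒᵖ X] [CStarModule Aᵐᵒᵖ X]
  [NormedAddCommGroup Y] [NormedSpace ℂ Y] [Module Bᵐᵒᵖ Y] [CStarModule Bᵐᵒᵖ Y]
  [NormedAddCommGroup W] [NormedSpace ℂ W] [Module Bᵐᵒᵖ W] [CStarModule Bᵐᵒᵖ W]
  {π : HilbertRep A B Y} {t : X →ₗ[ℂ] Y →ₗ[ℂ] W}

namespace IsInternalTensor

section LeftAction

variable {C : Type*} [CStarAlgebra C]

omit [StarOrderedRing B] in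
theorem rinner_lift_map_left (ht : IsInternalTensor π t) (κ : HilbertRep C A X) (c : C)
    (u w : X ⊗[ℂ] Y) :
    rinner B (TensorProduct.lift t (TensorProduct.map (κ c) .id u)) (TensorProduct.lift t w) =
      rinner B (TensorProduct.lift t u)
        (TensorProduct.lift t (TensorProduct.map (κ (star c)) .id w)) := by
  induction u with
  | zero => simp [rinner]
  | add u₁ u₂ h₁ h₂ => simp only [map_add, rinner_add_left, h₁, h₂]
  | tmul x y =>
    induction w with
    | zero => simp [rinner]
    | add w₁ w₂ h₁ h₂ => simp only [map_add, rinner_add_right, h₁, h₂]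
    | tmul x' y' =>
      simp only [TensorProduct.map_tmul, TensorProduct.lift.tmul, LinearMap.id_apply,
        ht.rinner_tmul, κ.adjoint]

/-- The argument of `HilbertRep.norm_apply_le`, run on algebraic tensors, where the operator is
already defined and has a formal adjoint. -/
theorem norm_lift_map_left_le [PartialOrder C] [StarOrderedRing C] (ht : IsInternalTensor π t)
    (κ : HilbertRep C A X) (c : C) (u : X ⊗[ℂ] Y) :
    ‖TensorProduct.lift t (TensorProduct.map (κ c) .id u)‖ ≤
      ‖c‖ * ‖TensorProduct.lift t u‖ := by
  obtain ⟨d, hd⟩ := CStarAlgebra.exists_star_mul_self_add c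
  have hmul : ∀ a b : C, TensorProduct.map (κ a) .id (TensorProduct.map (κ b) .id u) =
      TensorProduct.map (κ (a * b)) (.id : Y →ₗ[ℂ] Y) u := by
    intro a b
    rw [map_mul, TensorProduct.map_map]
    rfl
  rw [← sq_le_sq₀ (norm_nonneg _) (by positivity), ← norm_rinner_self B, mul_pow,
    ← norm_rinner_self B (TensorProduct.lift t u)]
  refine norm_le_of_add_eq_smul
    (q := rinner B (TensorProduct.lift t (TensorProduct.map (κ d) .id u))
      (TensorProduct.lift t (TensorProduct.map (κ d) .id u))) (by positivity)
    (rinner_self_nonneg _ _) (rinner_self_nonneg _ _) ?_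
  rw [ht.rinner_lift_map_left, ht.rinner_lift_map_left, ← rinner_add_right, ← map_add, hmul, hmul,
    ← LinearMap.add_apply, ← TensorProduct.map_add_left, ← map_add, hd, κ.hom.commutes]
  have e : TensorProduct.map (algebraMap ℂ (Module.End ℂ X) ((‖c‖ ^ 2 : ℝ) : ℂ)) .id u =
      ((‖c‖ ^ 2 : ℝ) : ℂ) • u := by
    rw [Algebra.algebraMap_eq_smul_one, TensorProduct.map_smul_left, Module.End.one_eq_id,
      TensorProduct.map_id, LinearMap.smul_apply, LinearMap.id_apply]
  rw [e, map_smul, rinner_smul_right]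

/-- A left action on `X` induces a left action on `X ⊗_A Y`. -/
theorem exists_leftAction [PartialOrder C] [StarOrderedRing C] [CompleteSpace W]
    (ht : IsInternalTensor π t) (κ : HilbertRep C A X) :
    ∃ κW : HilbertRep C B W, ∀ c x y, κW c (t x y) = t (κ c x) y := by
  choose F hF using fun c => ht.exists_extension (κ c) .id ‖c‖ (ht.norm_lift_map_left_le κ c)
  simp only [LinearMap.id_apply] at hF
  refine ⟨
    { hom :=
        { toFun := fun c => (F c).toLinearMap
          map_one' := LinearMap.ext <| ht.map_ext (F 1).continuous continuous_id (map_add _)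
            (fun _ _ => rfl) (map_zero _) fun x y => by
              change F 1 (t x y) = t x y
              rw [hF, map_one, Module.End.one_apply]
          map_mul' := fun a b => LinearMap.ext <| ht.map_ext (F (a * b)).continuous
            ((F a).continuous.comp (F b).continuous) (map_add _) (map_add (F a ∘L F b))
            ((map_zero _).trans (map_zero (F a ∘L F b)).symm) fun x y => by
              change F (a * b) (t x y) = F a (F b (t x y))
              rw [hF, hF, hF, map_mul, Module.End.mul_apply]
          map_zero' := LinearMap.ext <| ht.map_ext (F 0).continuous continuous_const (map_add _)
            (fun _ _ => (add_zero _).symm) (map_zero _) fun x y => by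
              change F 0 (t x y) = 0
              rw [hF, map_zero, LinearMap.zero_apply, map_zero, LinearMap.zero_apply]
          map_add' := fun a b => LinearMap.ext <| ht.map_ext (F (a + b)).continuous
            (F a + F b).continuous (map_add _) (map_add (F a + F b))
            ((map_zero _).trans (map_zero (F a + F b)).symm) fun x y => by
              change F (a + b) (t x y) = F a (t x y) + F b (t x y)
              rw [hF, hF, hF, map_add, LinearMap.add_apply, map_add, LinearMap.add_apply]
          commutes' := fun z => LinearMap.ext <| ht.map_ext (F _).continuous
            (continuous_const_smul z) (map_add _) (smul_add z)
            ((map_zero _).trans (smul_zero z).symm) fun x y => by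
              change F (algebraMap ℂ C z) (t x y) = z • t x y
              rw [hF, κ.hom.commutes, Module.algebraMap_end_apply, map_smul,
                LinearMap.smul_apply] }
      adjoint := fun c w w' => ?_ }, hF⟩
  change rinner B (F c w) w' = rinner B w (F (star c) w')
  -- Density is used once in each variable, reducing the adjoint relation to simple tensors.
  refine ht.map_ext (f := fun w => rinner B (F c w) w') (g := fun w => rinner B w (F (star c) w'))
    ((continuous_rinner B).comp ((F c).continuous.prodMk continuous_const))
    ((continuous_rinner B).comp (continuous_id.prodMk continuous_const))
    (fun _ _ => by rw [map_add, rinner_add_left]) (fun _ _ => rinner_add_left B _ _ _)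
    (by simp [rinner]) (fun x y => ?_) w
  refine ht.map_ext (f := fun w' => rinner B (F c (t x y)) w')
    (g := fun w' => rinner B (t x y) (F (star c) w'))
    ((continuous_rinner B).comp (continuous_const.prodMk continuous_id))
    ((continuous_rinner B).comp (continuous_const.prodMk (F (star c)).continuous))
    (fun _ _ => rinner_add_right B _ _ _) (fun _ _ => by rw [map_add, rinner_add_right])
    (by simp [rinner]) (fun x' y' => ?_) w'
  simp only [hF, ht.rinner_tmul, κ.adjoint]

end LeftAction

section Action

variable {C G : Type*} [CStarAlgebra C] [PartialOrder C] [StarOrderedRing C] [Group G]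
  {R : TwistedSystem C G} {S : TwistedSystem A G} {T : TwistedSystem B G}

omit [PartialOrder C] [StarOrderedRing C] [StarOrderedRing B] in
-- On simple tensors, `dX` turns the inner `⟨x, x'⟩` into its image under `S.α g`; covariance of
-- `dY` pulls this automorphism out as `dY.δ g`, and the inner product of `Y` then yields `T.α g`.
theorem rinner_lift_map_δ (ht : IsInternalTensor π t) {κ : HilbertRep C A X}
    (dX : CompatibleAction R S κ) (dY : CompatibleAction S T π) (g : G) (u w : X ⊗[ℂ] Y) :
    rinner B (TensorProduct.lift t (TensorProduct.map (dX.δ g : X →ₗ[ℂ] X) (dY.δ g : Y →ₗ[ℂ] Y) u))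
        (TensorProduct.lift t (TensorProduct.map (dX.δ g : X →ₗ[ℂ] X) (dY.δ g : Y →ₗ[ℂ] Y) w)) =
      T.α g (rinner B (TensorProduct.lift t u) (TensorProduct.lift t w)) := by
  induction u with
  | zero => simp [rinner]
  | add u₁ u₂ h₁ h₂ => simp only [map_add, rinner_add_left, h₁, h₂]
  | tmul x y =>
    induction w with
    | zero => simp [rinner]
    | add w₁ w₂ h₁ h₂ => simp only [map_add, rinner_add_right, h₁, h₂]
    | tmul x' y' =>
      simp only [TensorProduct.map_tmul, TensorProduct.lift.tmul, ht.rinner_tmul]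
      change rinner B (dY.δ g y) (π (rinner A (dX.δ g x) (dX.δ g x')) (dY.δ g y')) = _
      rw [dX.rinner_δ, ← dY.δ_left, dY.rinner_δ]

omit [PartialOrder C] [StarOrderedRing C] [StarOrderedRing B] in
theorem norm_lift_map_δ (ht : IsInternalTensor π t) {κ : HilbertRep C A X}
    (dX : CompatibleAction R S κ) (dY : CompatibleAction S T π) (g : G) (u : X ⊗[ℂ] Y) :
    ‖TensorProduct.lift t (TensorProduct.map (dX.δ g : X →ₗ[ℂ] X) (dY.δ g : Y →ₗ[ℂ] Y) u)‖ =
      ‖TensorProduct.lift t u‖ := by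
  rw [← sq_eq_sq₀ (norm_nonneg _) (norm_nonneg _), ← norm_rinner_self B, ← norm_rinner_self B,
    ht.rinner_lift_map_δ]
  exact NonUnitalStarAlgHom.norm_map (T.α g) (T.α g).injective _

/-- The diagonal action of `G` on an internal tensor product. -/
theorem exists_compatibleAction [CompleteSpace W] (ht : IsInternalTensor π t)
    {κ : HilbertRep C A X} (dX : CompatibleAction R S κ) (dY : CompatibleAction S T π)
    {κW : HilbertRep C B W} (hκ : ∀ c x y, κW c (t x y) = t (κ c x) y) :
    ∃ dW : CompatibleAction R T κW, ∀ g x y, dW.δ g (t x y) = t (dX.δ g x) (dY.δ g y) := by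
  choose D hD using fun g => ht.exists_extension (dX.δ g) (dY.δ g) 1
    fun u => by rw [ht.norm_lift_map_δ dX dY, one_mul]
  -- The inverse is bounded because the forward map is isometric: apply `norm_lift_map_δ` to the
  -- image of `u` under the inverse.
  choose D' hD' using fun g => ht.exists_extension (dX.δ g).symm (dY.δ g).symm 1 fun u => by
    rw [one_mul, ← ht.norm_lift_map_δ dX dY g, TensorProduct.map_map]
    refine le_of_eq (congrArg (fun v => ‖TensorProduct.lift t v‖) ?_)
    conv_rhs => rw [← LinearMap.id_apply (R := ℂ) u, ← TensorProduct.map_id]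
    congr 2 <;> ext <;> simp
  have hD (g : G) (x : X) (y : Y) : D g (t x y) = t (dX.δ g x) (dY.δ g y) := hD g x y
  have hD' (g : G) (x : X) (y : Y) : D' g (t x y) = t ((dX.δ g).symm x) ((dY.δ g).symm y) :=
    hD' g x y
  refine ⟨
    { δ := fun g => ContinuousLinearEquiv.equivOfInverse (D g) (D' g)
        (ht.map_ext (by fun_prop) continuous_id (map_add (D' g ∘L D g)) (fun _ _ => rfl)
          (map_zero (D' g ∘L D g)) fun x y => by
            rw [hD, hD', ContinuousLinearEquiv.symm_apply_apply,
              ContinuousLinearEquiv.symm_apply_apply])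
        (ht.map_ext (by fun_prop) continuous_id (map_add (D g ∘L D' g)) (fun _ _ => rfl)
          (map_zero (D g ∘L D' g)) fun x y => by
            rw [hD', hD, ContinuousLinearEquiv.apply_symm_apply,
              ContinuousLinearEquiv.apply_symm_apply])
      δ_left := fun g c => ?_
      δ_right := fun g b => ?_
      δ_mul := fun g h => ?_
      rinner_δ := fun g w w' => ?_ }, hD⟩
  · have h₁ := κW.continuous_apply c
    have h₂ := κW.continuous_apply (R.α g c)
    exact ht.map_ext (f := fun w => D g (κW c w)) (g := fun w => κW (R.α g c) (D g w))
      (by fun_prop) (by fun_prop) (by simp) (by simp) (by simp)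
      fun x y => by rw [hκ, hD, hD, hκ, dX.δ_left]
  · have h₁ := continuous_op_smul (W := W) B b
    have h₂ := continuous_op_smul (W := W) B (T.α g b)
    exact ht.map_ext (f := fun w => D g (op b • w)) (g := fun w => op (T.α g b) • D g w)
      (by fun_prop) (h₂.comp (D g).continuous) (by simp) (by simp) (by simp)
      fun x y => by rw [ht.op_smul_tmul, hD, hD, ht.op_smul_tmul, dY.δ_right]
  · have h₁ := κW.continuous_apply (R.σ g h : C)
    have h₂ := continuous_op_smul (W := W) B (star (T.σ g h : B))
    refine ht.map_ext (f := fun w => D g (D h w))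
      (g := fun w => op (star (T.σ g h : B)) • κW (R.σ g h : C) (D (g * h) w))
      (by fun_prop) (h₂.comp (h₁.comp (D (g * h)).continuous)) (by simp) (by simp) (by simp)
      fun x y => ?_
    -- The action on `X` leaves `S.σ(g,h)*` on the right of `x`, the one on `Y` leaves `S.σ(g,h)` on
    -- the left of `y`. Balancing brings them together and they cancel by unitarity.
    rw [hD, hD, hD, hκ, ht.op_smul_tmul, dX.δ_mul, dY.δ_mul, ht.op_smul_tmul_eq, π.op_smul,
      ← Module.End.mul_apply, ← map_mul, Unitary.coe_star_mul_self, map_one,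
      Module.End.one_apply]
  · have hc : Continuous (T.α g) := (NonUnitalStarAlgHom.isometry (T.α g)
      (T.α g).injective).continuous
    change rinner B (D g w) (D g w') = T.α g (rinner B w w')
    refine ht.map_ext (f := fun w => rinner B (D g w) (D g w'))
      (g := fun w => T.α g (rinner B w w'))
      ((continuous_rinner B).comp ((D g).continuous.prodMk continuous_const))
      (hc.comp ((continuous_rinner B).comp (continuous_id.prodMk continuous_const)))
      (fun _ _ => by rw [map_add, rinner_add_left])
      (fun _ _ => by rw [rinner_add_left, map_add]) (by simp [rinner]) (fun x y => ?_) w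
    refine ht.map_ext (f := fun w' => rinner B (D g (t x y)) (D g w'))
      (g := fun w' => T.α g (rinner B (t x y) w'))
      ((continuous_rinner B).comp (continuous_const.prodMk (D g).continuous))
      (hc.comp ((continuous_rinner B).comp (continuous_const.prodMk continuous_id)))
      (fun _ _ => by rw [map_add, rinner_add_right])
      (fun _ _ => by rw [rinner_add_right, map_add]) (by simp [rinner]) (fun x' y' => ?_) w'
    simp only [hD, ht.rinner_tmul]
    rw [dX.rinner_δ, ← dY.δ_left, dY.rinner_δ]

end Action

end IsInternalTensor

end InternalTensorMaps

/-! ### Coefficients of tensor products -/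

section Coefficients

variable {A B C G X Y W : Type*} [CStarAlgebra A] [PartialOrder A] [CStarAlgebra B]
  [PartialOrder B] [CStarAlgebra C] [Group G]
  {R : TwistedSystem C G} {S : TwistedSystem A G} {T : TwistedSystem B G}
  [NormedAddCommGroup X] [NormedSpace ℂ X] [Module Aᵐᵒᵖ X] [CStarModule Aᵐᵒᵖ X]
  [NormedAddCommGroup Y] [NormedSpace ℂ Y] [Module Bᵐᵒᵖ Y] [CStarModule Bᵐᵒᵖ Y]
  [NormedAddCommGroup W] [NormedSpace ℂ W] [Module Bᵐᵒᵖ W] [CStarModule Bᵐᵒᵖ W]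

/-- The heart of the matter: in `⟨y, ⟨x, c · δ(g) x'⟩ · δ(g) y'⟩` the value of the first coefficient
is the algebra argument of the second. This is why the product reverses the order of the tensor
factors. -/
theorem IsInternalTensor.coeffMul_coeff {κ : HilbertRep C A X} {π : HilbertRep A B Y}
    {κW : HilbertRep C B W} {t : X →ₗ[ℂ] Y →ₗ[ℂ] W} (ht : IsInternalTensor π t)
    (dX : CompatibleAction R S κ) (dY : CompatibleAction S T π) (dW : CompatibleAction R T κW)
    (hκ : ∀ c x y, κW c (t x y) = t (κ c x) y)
    (hd : ∀ g x y, dW.δ g (t x y) = t (dX.δ g x) (dY.δ g y)) (x x' : X) (y y' : Y) :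
    coeffMul (dY.coeff y y') (dX.coeff x x') = dW.coeff (t x y) (t x' y') := by
  ext g c
  change rinner B y (π (rinner A x (κ c (dX.δ g x'))) (dY.δ g y')) =
    rinner B (t x y) (κW c (dW.δ g (t x' y')))
  rw [hd, hκ, ht.rinner_tmul]

/-- An equivariant representation of `S` is an `(S, S)`-compatible action. -/
def EquivariantRep.toCompatibleAction (r : EquivariantRep S X) : CompatibleAction S S r.ρ where
  δ := r.v
  δ_left g a x := by rw [r.covariant, ContinuousLinearEquiv.symm_apply_apply]
  δ_right := r.v_op_smul
  δ_mul := r.v_mul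
  rinner_δ g x y := (r.rinner_v g x y).symm

/-- An `(S, S)`-compatible action is an equivariant representation of `S`. -/
def CompatibleAction.toEquivariantRep {ρ : HilbertRep A A X} (d : CompatibleAction S S ρ) :
    EquivariantRep S X where
  ρ := ρ
  v := d.δ
  covariant g a x := by rw [d.δ_left, ContinuousLinearEquiv.apply_symm_apply]
  v_mul := d.δ_mul
  rinner_v g x y := (d.rinner_δ g x y).symm
  v_op_smul := d.δ_right

end Coefficients

/-! ### Transfer of coefficients between the two systems. -/

section Transfer

variable {A B G : Type u} [CStarAlgebra A] [PartialOrder A] [StarOrderedRing A]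
  [CStarAlgebra B] [PartialOrder B] [StarOrderedRing B] [Group G]
  {S : TwistedSystem A G} {T : TwistedSystem B G}

/-- The outer factors are arbitrary compatible actions in opposite directions rather than `Z̃` and
`Z`. The same statement then serves both directions of the transfer, with no double conjugate. -/
theorem EquivariantRep.exists_tensor {V X Z : Type u}
    [NormedAddCommGroup V] [NormedSpace ℂ V] [Module Aᵐᵒᵖ V] [CStarModule Aᵐᵒᵖ V]
    [NormedAddCommGroup X] [NormedSpace ℂ X] [Module Aᵐᵒᵖ X] [CStarModule Aᵐᵒᵖ X]
    [NormedAddCommGroup Z] [NormedSpace ℂ Z] [Module Bᵐᵒᵖ Z] [CStarModule Bᵐᵒᵖ Z]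
    {μ : HilbertRep B A V} (e : CompatibleAction T S μ) (r : EquivariantRep S X)
    {κ : HilbertRep A B Z} (d : CompatibleAction S T κ) :
    ∃ (W : Type u) (_ : NormedAddCommGroup W) (_ : NormedSpace ℂ W) (_ : CompleteSpace W)
      (_ : Module Aᵐᵒᵖ W) (_ : CStarModule Aᵐᵒᵖ W) (t : V →ₗ[ℂ] X →ₗ[ℂ] W)
      (κW : HilbertRep B A W) (dW : CompatibleAction T S κW)
      (Y : Type u) (_ : NormedAddCommGroup Y) (_ : NormedSpace ℂ Y) (_ : CompleteSpace Y)
      (_ : Module Bᵐᵒᵖ Y) (_ : CStarModule Bᵐᵒᵖ Y) (s : W →ₗ[ℂ] Z →ₗ[ℂ] Y)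
      (q : EquivariantRep T Y),
      IsInternalTensor r.ρ t ∧
      (∀ b z x, κW b (t z x) = t (μ b z) x) ∧
      (∀ g z x, dW.δ g (t z x) = t (e.δ g z) (r.v g x)) ∧
      IsInternalTensor κ s ∧
      (∀ b y z, q.ρ b (s y z) = s (κW b y) z) ∧
      (∀ g y z, q.v g (s y z) = s (dW.δ g y) (d.δ g z)) ∧
      ∀ (x x' : X) (v v' : V) (z z' : Z),
        coeffMul (coeffMul (d.coeff z z') (r.coeff x x')) (e.coeff v v') =
          q.coeff (s (t v x) z) (s (t v' x') z') := by
  obtain ⟨W, _, _, _, _, _, t, ht⟩ := exists_isInternalTensor (X := V) r.ρ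
  obtain ⟨κW, hκW⟩ := ht.exists_leftAction μ
  obtain ⟨dW, hdW⟩ := ht.exists_compatibleAction e r.toCompatibleAction hκW
  obtain ⟨Y, _, _, _, _, _, s, hs⟩ := exists_isInternalTensor (X := W) κ
  obtain ⟨τ, hτ⟩ := hs.exists_leftAction κW
  obtain ⟨w, hw⟩ := hs.exists_compatibleAction dW d hτ
  refine ⟨W, _, _, inferInstance, _, _, t, κW, dW, Y, _, _, inferInstance, _, _, s,
    w.toEquivariantRep, ht, hκW, hdW, hs, hτ, hw, fun x x' v v' z z' => ?_⟩
  refine Eq.trans ?_ (hs.coeffMul_coeff dW d w hτ hw (t v x) (t v' x') z z')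
  rw [← ht.coeffMul_coeff e r.toCompatibleAction dW hκW hdW]
  -- The two bracketings of the triple product agree by definition, as do the coefficients of `r`
  -- and of `r.toCompatibleAction`.
  rfl

theorem EquivariantRep.coeffMul_coeff_mem {V X Z : Type u}
    [NormedAddCommGroup V] [NormedSpace ℂ V] [Module Aᵐᵒᵖ V] [CStarModule Aᵐᵒᵖ V]
    [NormedAddCommGroup X] [NormedSpace ℂ X] [Module Aᵐᵒᵖ X] [CStarModule Aᵐᵒᵖ X]
    [NormedAddCommGroup Z] [NormedSpace ℂ Z] [Module Bᵐᵒᵖ Z] [CStarModule Bᵐᵒᵖ Z]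
    {μ : HilbertRep B A V} (e : CompatibleAction T S μ) (r : EquivariantRep S X)
    {κ : HilbertRep A B Z} (d : CompatibleAction S T κ) (x x' : X) (v v' : V) (z z' : Z) :
    coeffMul (coeffMul (d.coeff z z') (r.coeff x x')) (e.coeff v v') ∈ fourierStieltjes T := by
  obtain ⟨W, _, _, _, _, _, t, κW, dW, Y, _, _, _, _, _, s, q, -, -, -, -, -, -, h⟩ :=
    r.exists_tensor e d
  exact ⟨Y, _, _, inferInstance, _, _, q, _, _, h x x' v v' z z'⟩

/-- Multiplication by coefficients of compatible actions maps `B(S)` linearly into `B(T)`. -/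
theorem exists_linearMap_fourierStieltjes {V Z : Type u}
    [NormedAddCommGroup V] [NormedSpace ℂ V] [Module Aᵐᵒᵖ V] [CStarModule Aᵐᵒᵖ V]
    [NormedAddCommGroup Z] [NormedSpace ℂ Z] [Module Bᵐᵒᵖ Z] [CStarModule Bᵐᵒᵖ Z]
    {μ : HilbertRep B A V} (e : CompatibleAction T S μ)
    {κ : HilbertRep A B Z} (d : CompatibleAction S T κ) (v v' : V) (z z' : Z) :
    ∃ F : fourierStieltjes S →ₗ[ℂ] fourierStieltjes T, ∀ U : fourierStieltjes S,
      (F U : G → B →ₗ[ℂ] B) =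
        coeffMul (coeffMul (d.coeff z z') (U : G → A →ₗ[ℂ] A)) (e.coeff v v') := by
  -- The product makes sense for every map `G × A → A`, so independence of the representation
  -- realizing a coefficient is automatic; only membership in `fourierStieltjes T` needs a
  -- representation.
  let L : (G → A →ₗ[ℂ] A) →ₗ[ℂ] (G → B →ₗ[ℂ] B) :=
    { toFun := fun U => coeffMul (coeffMul (d.coeff z z') U) (e.coeff v v')
      map_add' := fun U U' => by ext g b; exact map_add (d.coeff z z' g) _ _
      map_smul' := fun c U => by ext g b; exact map_smul (d.coeff z z' g) c _ }
  refine ⟨L.restrict (p := fourierStieltjes S) (q := fourierStieltjes T) ?_, fun U => rfl⟩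
  rintro _ ⟨X, _, _, _, _, _, r, x, x', rfl⟩
  exact r.coeffMul_coeff_mem e d x x' v v' z z'

end Transfer

theorem mainTheorem4 {A B G : Type u}
    [CStarAlgebra A] [PartialOrder A] [StarOrderedRing A]
    [CStarAlgebra B] [PartialOrder B] [StarOrderedRing B] [Group G]
    (S : TwistedSystem A G) (T : TwistedSystem B G)
    {Z : Type u} [NormedAddCommGroup Z] [NormedSpace ℂ Z] [CompleteSpace Z]
    [Module Bᵐᵒᵖ Z] [CStarModule Bᵐᵒᵖ Z]
    (I : ImprimitivityBimodule A B Z) (d : CompatibleAction S T I.κ) :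
    -- for every equivariant representation of `S` there is a realization of
    -- `Y = (Z̃ ⊗_A X) ⊗_A Z` and an equivariant representation `(τ, w)` of `T` on `Y`, given on
    -- simple tensors by the expected formulas, which has the products as its coefficients
    (∀ (X : Type u) [NormedAddCommGroup X] [NormedSpace ℂ X] [CompleteSpace X]
        [Module Aᵐᵒᵖ X] [CStarModule Aᵐᵒᵖ X] (r : EquivariantRep S X),
      (∃ (W : Type u) (_ : NormedAddCommGroup W) (_ : NormedSpace ℂ W) (_ : CompleteSpace W)
          (_ : Module Aᵐᵒᵖ W) (_ : CStarModule Aᵐᵒᵖ W) (t : I.Conj →ₗ[ℂ] X →ₗ[ℂ] W)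
          (κW : HilbertRep B A W) (dW : CompatibleAction T S κW)
          (Y : Type u) (_ : NormedAddCommGroup Y) (_ : NormedSpace ℂ Y) (_ : CompleteSpace Y)
          (_ : Module Bᵐᵒᵖ Y) (_ : CStarModule Bᵐᵒᵖ Y) (s : W →ₗ[ℂ] Z →ₗ[ℂ] Y)
          (q : EquivariantRep T Y),
        IsInternalTensor r.ρ t ∧
        (∀ b z x, κW b (t z x) = t (I.conjκ b z) x) ∧
        (∀ g z x, dW.δ g (t z x) = t (d.conj.δ g z) (r.v g x)) ∧
        IsInternalTensor I.κ s ∧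
        (∀ b y z, q.ρ b (s y z) = s (κW b y) z) ∧
        (∀ g y z, q.v g (s y z) = s (dW.δ g y) (d.δ g z)) ∧
        ∀ (x x' : X) (z z' ζ ζ' : Z),
          coeffMul (coeffMul (d.coeff z' ζ') (r.coeff x x'))
              (d.conj.coeff (I.tilde z) (I.tilde ζ)) =
            q.coeff (s (t (I.tilde z) x) z') (s (t (I.tilde ζ) x') ζ')) ∧
      ∀ (x x' : X) (z z' ζ ζ' : Z),
        coeffMul (coeffMul (d.coeff z' ζ') (r.coeff x x'))
          (d.conj.coeff (I.tilde z) (I.tilde ζ)) ∈ fourierStieltjes T) ∧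
    -- the linear maps `B(S) → B(T)` and `B(T) → B(S)`
    (∀ z z' ζ ζ' : Z,
      ∃ F : fourierStieltjes S →ₗ[ℂ] fourierStieltjes T, ∀ U : fourierStieltjes S,
        (F U : G → B →ₗ[ℂ] B) =
          coeffMul (coeffMul (d.coeff z' ζ') (U : G → A →ₗ[ℂ] A))
            (d.conj.coeff (I.tilde z) (I.tilde ζ))) ∧
    (∀ z z' ζ ζ' : Z,
      ∃ F' : fourierStieltjes T →ₗ[ℂ] fourierStieltjes S, ∀ U : fourierStieltjes T,
        (F' U : G → A →ₗ[ℂ] A) =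
          coeffMul (coeffMul (d.conj.coeff (I.tilde z) (I.tilde ζ)) (U : G → B →ₗ[ℂ] B))
            (d.coeff z' ζ')) := by
  refine ⟨fun X _ _ _ _ _ r => ⟨?_, fun x x' z z' ζ ζ' =>
      r.coeffMul_coeff_mem d.conj d x x' (I.tilde z) (I.tilde ζ) z' ζ'⟩,
    fun z z' ζ ζ' => exists_linearMap_fourierStieltjes d.conj d _ _ _ _,
    -- The roles of `Z` and `Z̃` are exchanged: the representation space is now `(Z ⊗_B X) ⊗_B Z̃`.
    fun z z' ζ ζ' => exists_linearMap_fourierStieltjes d d.conj _ _ _ _⟩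
  obtain ⟨W, i₁, i₂, i₃, i₄, i₅, t, κW, dW, Y, j₁, j₂, j₃, j₄, j₅, s, q,
    h₁, h₂, h₃, h₄, h₅, h₆, h⟩ := r.exists_tensor d.conj d
  exact ⟨W, i₁, i₂, i₃, i₄, i₅, t, κW, dW, Y, j₁, j₂, j₃, j₄, j₅, s, q, h₁, h₂, h₃, h₄, h₅, h₆,
    fun x x' z z' ζ ζ' => h x x' _ _ z' ζ'⟩
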